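/- All graphs are finite and simple. A graph is an atom if it has no clique cut-set, that is, if there is no (possibly empty) clique $K$ such that $G\setminus K$ is disconnected. A graph is $(H_1,H_2)$-free if it contains neither $H_1$ nor $H_2$ as an induced subgraph. For $1\le h\le i\le j$ the subdivided claw $S_{h,i,j}$ is the tree with one vertex $x$ of degree $3$ and exactly three leaves, at distance $h$, $i$ and $j$ from $x$; $\mathcal S$ is the class of graphs every connected component of which is a subdivided claw or a path on at least one vertex. The clique-width $\mathrm{cw}(G)$ is the minimum number of labels needed to construct $G$ by creating labelled vertices, taking disjoint unions, adding all edges between vertices labelled $i$ and vertices labelled $j$ ($i\neq j$), and relabelling $i$ to $j$; a class of graphs has bounded clique-width if some constant bounds the clique-width of all its members, and unbounded clique-width otherwise. For $n\ge 2$, the wall of height $n$ is the graph on the points $(x,y)$ with $0\le x\le 2n+1$, $0\le y\le n$, in which $(x,y)$ and $(x+1,y)$ are adjacent and $(x,y)$ and $(x,y+1)$ are adjacent if $x+y$ is odd, after deletion of its two vertices of degree one. The $k$-subdivided wall of height $n$ is obtained from it by replacing every edge by a path with $k+1$ edges. Let $H_1,H_2$ be graphs and let $k=\max(|V(H_1)|,|V(H_2)|)$.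 If $H_1,H_2\notin\mathcal S$ or $\overline{H_1},\overline{H_2}\notin\mathcal S$, then the class of $(H_1,H_2)$-free atoms has unbounded clique-width. More precisely: 1. if $H_1,H_2\notin\mathcal S$, then every $k$-subdivided wall of height at least $2$ is an $(H_1,H_2)$-free atom, and these walls have unbounded clique-width; 2. if $\overline{H_1},\overline{H_2}\notin\mathcal S$, then the complement of every $k$-subdivided wall of height at least $2$ is an $(H_1,H_2)$-free atom, and these complements have unbounded clique-width. -/

import Mathlib

open SimpleGraph

namespace AtomsCW

/-! ### Clique-width -/

/-- `Constructible k V G a`: the graph `G` with vertex labelling `a : V → Fin k` can be built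
using at most `k` labels by the operations of clique-width. The last constructor says that
labelled graphs are considered up to isomorphism. -/
inductive Constructible (k : ℕ) : (V : Type) → SimpleGraph V → (V → Fin k) → Prop
  /-- create a single vertex with label `i` -/
  | vertex (i : Fin k) : Constructible k Unit ⊥ (fun _ => i)
  /-- disjoint union of two labelled graphs -/
  | union {V W : Type} {G : SimpleGraph V} {H : SimpleGraph W} {a : V → Fin k} {b : W → Fin k} :
      Constructible k V G a → Constructible k W H b →
        Constructible k (V ⊕ W) (G ⊕g H) (Sum.elim a b)
  /-- add all edges between the vertices with label `i` and the vertices with label `j ≠ i` -/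
  | join {V : Type} {G : SimpleGraph V} {a : V → Fin k} (i j : Fin k) (hij : i ≠ j) :
      Constructible k V G a →
        Constructible k V (G ⊔ SimpleGraph.fromRel (fun u v => a u = i ∧ a v = j)) a
  /-- give label `j` to every vertex with label `i` -/
  | relabel {V : Type} {G : SimpleGraph V} {a : V → Fin k} (i j : Fin k) :
      Constructible k V G a → Constructible k V G (fun v => if a v = i then j else a v)
  /-- rename the vertices -/
  | iso {V W : Type} {G : SimpleGraph V} {H : SimpleGraph W} {a : V → Fin k} (e : G ≃g H) :
      Constructible k V G a → Constructible k W H (fun w => a (e.symm w))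

/-- The clique-width of a finite graph: the minimum number of labels needed to construct it.
(The set below is nonempty for every nonempty finite graph, see `exists_constructible`;
the graph without vertices gets the value `0`.) -/
noncomputable def cliqueWidth {V : Type} (G : SimpleGraph V) : ℕ :=
  sInf {k : ℕ | ∃ a : V → Fin k, Constructible k V G a}

theorem constructible_bot (k : ℕ) : ∀ (n : ℕ) (a : Fin (n + 1) → Fin k),
    Constructible k (Fin (n + 1)) ⊥ a := by
  intro n
  induction n with
  | zero =>
    intro a
    have e : (⊥ : SimpleGraph Unit) ≃g (⊥ : SimpleGraph (Fin 1)) :=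
      ⟨Equiv.ofUnique _ _, by simp⟩
    have h := (Constructible.vertex (a 0)).iso e
    convert h using 1
    funext w
    congr 1
    omega
  | succ n ih =>
    intro a
    have h := (ih (fun i => a (Fin.castSucc i))).union (Constructible.vertex (a (Fin.last _)))
    let f : Fin (n + 1) ⊕ Unit ≃ Fin (n + 2) :=
      (Equiv.sumCongr (Equiv.refl _) (Equiv.ofUnique Unit (Fin 1))).trans finSumFinEquiv
    have h2 := h.iso (⟨f, by rintro (x | x) (y | y) <;> simp⟩ :
      ((⊥ : SimpleGraph (Fin (n + 1))) ⊕g (⊥ : SimpleGraph Unit)) ≃g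
        (⊥ : SimpleGraph (Fin (n + 2))))
    convert h2 using 1
    funext w
    obtain ⟨x, rfl⟩ := f.surjective w
    change a (f x) = Sum.elim _ _ (f.symm (f x))
    rw [Equiv.symm_apply_apply]
    rcases x with x | x
    · rfl
    · simp [f]
      congr 1

/-- Every nonempty finite graph can be constructed with finitely many labels. -/
theorem exists_constructible {V : Type} [Finite V] [Nonempty V] (G : SimpleGraph V) :
    ∃ (k : ℕ) (a : V → Fin k), Constructible k V G a := by
  classical
  obtain ⟨m, ⟨f⟩⟩ := Finite.exists_equiv_fin V
  obtain ⟨n, rfl⟩ : ∃ n, m = n + 1 :=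
    Nat.exists_eq_succ_of_ne_zero (by rintro rfl; exact (f (Classical.arbitrary V)).elim0)
  refine ⟨n + 1, f, ?_⟩
  have h0 : Constructible (n + 1) V ⊥ f := by
    have h := (constructible_bot (n + 1) n id).iso
      (⟨f.symm, by simp⟩ : (⊥ : SimpleGraph (Fin (n + 1))) ≃g (⊥ : SimpleGraph V))
    exact h
  have := Fintype.ofFinite V
  have key : ∀ s : Finset (V × V), (∀ p ∈ s, p.1 ≠ p.2) →
      Constructible (n + 1) V (SimpleGraph.fromRel (fun u v => (u, v) ∈ s)) f := by
    intro s
    induction s using Finset.induction_on with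
    | empty =>
      intro _
      convert h0 using 1
      ext u v
      simp [SimpleGraph.fromRel_adj]
    | insert p s hp ih =>
      intro hs
      have h1 := (ih (fun q hq => hs q (Finset.mem_insert_of_mem hq))).join (f p.1) (f p.2)
        (fun h => hs p (Finset.mem_insert_self _ _) (f.injective h))
      convert h1 using 1
      ext u v
      obtain ⟨x, y⟩ := p
      simp only [SimpleGraph.fromRel_adj, SimpleGraph.sup_adj, Finset.mem_insert, Prod.mk.injEq,
        f.injective.eq_iff]
      tauto
  have h1 := key (Finset.univ.filter (fun p => G.Adj p.1 p.2))
    (fun p hp => (Finset.mem_filter.1 hp).2.ne)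
  convert h1 using 1
  ext u v
  simp only [SimpleGraph.fromRel_adj, Finset.mem_filter, Finset.mem_univ, true_and]
  exact ⟨fun h => ⟨h.ne, Or.inl h⟩, fun h => h.2.elim id (fun h' => h'.symm)⟩

/-- A class of graphs has bounded clique-width if some constant bounds the clique-width of all
(finite) graphs in it. -/
def HasBoundedCliqueWidth (C : (V : Type) → SimpleGraph V → Prop) : Prop :=
  ∃ c : ℕ, ∀ (V : Type) [Finite V] (G : SimpleGraph V), C V G → cliqueWidth G ≤ c

/-! ### Atoms -/

/-- A clique whose removal leaves a disconnected graph, that is, a graph with two vertices that are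
not joined by a path. The empty clique is allowed; a graph without vertices is not disconnected. -/
def IsCliqueCutset {V : Type*} (G : SimpleGraph V) (K : Set V) : Prop :=
  G.IsClique K ∧ ¬ (G.induce Kᶜ).Preconnected

/-- A graph with no clique cut-set. -/
def IsAtom {V : Type*} (G : SimpleGraph V) : Prop :=
  ∀ K : Set V, ¬ IsCliqueCutset G K

/-- `G` is an `(H₁, H₂)`-free atom; `H ⊴ G` says that `H` is an induced subgraph of `G`, up to
isomorphism. -/
def IsFreeAtom {V₁ V₂ V : Type*} (H₁ : SimpleGraph V₁) (H₂ : SimpleGraph V₂)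
    (G : SimpleGraph V) : Prop :=
  ¬ H₁ ⊴ G ∧ ¬ H₂ ⊴ G ∧ IsAtom G

/-! ### The class `𝒮` -/

/-- `G` is the subdivided claw `S_{h,i,j}`: a tree with a vertex `x` of degree three and exactly
three leaves, at distance `h`, `i` and `j` from `x`. -/
def IsSubdividedClaw {V : Type*} (h i j : ℕ) (G : SimpleGraph V) : Prop :=
  G.IsTree ∧ ∃ x y₁ y₂ y₃ : V, (G.neighborSet x).ncard = 3 ∧
    y₁ ≠ y₂ ∧ y₁ ≠ y₃ ∧ y₂ ≠ y₃ ∧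
    {v : V | (G.neighborSet v).ncard = 1} = {y₁, y₂, y₃} ∧
    G.dist x y₁ = h ∧ G.dist x y₂ = i ∧ G.dist x y₃ = j

/-- The class `𝒮` of graphs every connected component of which is a subdivided claw or a path on at
least one vertex. -/
def InS {V : Type*} (G : SimpleGraph V) : Prop :=
  ∀ c : G.ConnectedComponent,
    (∃ h i j : ℕ, 1 ≤ h ∧ h ≤ i ∧ i ≤ j ∧ IsSubdividedClaw h i j c.toSimpleGraph) ∨
    (∃ n : ℕ, 1 ≤ n ∧ Nonempty (c.toSimpleGraph ≃g pathGraph n))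

/-! ### Subdivided walls -/

/-- The vertices of the wall of height `n`: the points `(x, y)` with `0 ≤ x ≤ 2n + 1` and
`0 ≤ y ≤ n`, except two corners (those that would have degree one in the wall). -/
abbrev WallVertex (n : ℕ) : Type :=
  {p : Fin (2 * n + 2) × Fin (n + 1) //
    ¬ (p.1.val = 0 ∧ p.2.val = 0) ∧
    ¬ (p.1.val = (if Even n then 2 * n + 1 else 0) ∧ p.2.val = n)}

/-- The wall of height `n`: `n` layers of `n` hexagonal bricks. All horizontal neighbours are
adjacent; `(x, y)` and `(x, y + 1)` are adjacent when `x + y` is odd. -/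
def wall (n : ℕ) : SimpleGraph (WallVertex n) :=
  SimpleGraph.fromRel (fun p q =>
    (p.1.1.val + 1 = q.1.1.val ∧ p.1.2.val = q.1.2.val) ∨
    (p.1.1.val = q.1.1.val ∧ p.1.2.val + 1 = q.1.2.val ∧ Odd (p.1.1.val + p.1.2.val)))

/-- The `k`-subdivision of `G`: every edge `e = uv` is replaced by the path
`u, (e, 0), …, (e, k - 1), v` with `k + 1` edges, for a chosen order `(u, v)` of the two ends of
`e`. For `k = 0` this is `G` itself. -/
noncomputable def subdivision {V : Type} (k : ℕ) (G : SimpleGraph V) :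
    SimpleGraph (V ⊕ (G.edgeSet × Fin k)) :=
  SimpleGraph.fromRel (fun s t =>
    match s, t with
    | Sum.inl u, Sum.inl v => k = 0 ∧ G.Adj u v
    | Sum.inl u, Sum.inr (e, p) =>
        (u = (Quot.out e.val).1 ∧ p.val = 0) ∨ (u = (Quot.out e.val).2 ∧ p.val + 1 = k)
    | Sum.inr (e, p), Sum.inr (f, q) => e = f ∧ p.val + 1 = q.val
    | Sum.inr _, Sum.inl _ => False)

/-- The `k`-subdivided wall of height `n`. -/
noncomputable abbrev subdividedWall (k n : ℕ) :
    SimpleGraph (WallVertex n ⊕ ((wall n).edgeSet × Fin k)) :=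
  subdivision k (wall n)

end AtomsCW

namespace AtomsCW

/-! Three facts about subdivided walls carry the theorem.

Freeness. A connected induced subgraph of the `k`-subdivided wall with at most `k` vertices cannot
contain two branch vertices, which are more than `k` apart. So it lies near one vertex of degree at
most three or inside one subdivided edge, and it is a subdivided claw or a path
(`isSubdividedClaw_or_path_of_embedding`). Hence graphs outside `𝒮` with at most `k` vertices are
not induced subgraphs; for the second case complement everything.

Atoms. A wall stays connected when any vertex is deleted, hence also when any edge is. A clique of
the subdivision lies around one branch vertex or inside one subdivided edge, so removing it does no
more harm (`subdivision_isAtom`). In the complement, two nonadjacent vertices lie on one subdivided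
edge; a disjoint edge supplies two common neighbours that are not adjacent to each other, and a
clique misses one of them (`subdivision_compl_isAtom`).

Clique-width. At every stage of a construction with `k` labels, the vertices present fall into at
most `k` classes with equal neighbourhoods outside the stage. In a graph of maximum degree three
such a set splits at most `3k` disjoint connected sets. Let a set be big if it contains a whole row
of a grid-like system of rows and columns. Singletons are small, the whole vertex set is big, and by
the splitting bound a union of two small stages is small when there are more than `6k` rows and
columns (`HasGrid.exists_big`); so `k` labels do not suffice. Equal outside neighbourhoods are
preserved by complementation, so the same argument bounds the clique-width of the complement. -/

/-! ### Walks inside a vertex set -/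

/-- `a` and `b` are joined by a walk of `G` all of whose edges have both ends in `S`. -/
def ReachIn {V : Type*} (G : SimpleGraph V) (S : Set V) : V → V → Prop :=
  Relation.ReflTransGen (fun a b => G.Adj a b ∧ a ∈ S ∧ b ∈ S)

theorem ReachIn.refl {V : Type*} {G : SimpleGraph V} {S : Set V} (a : V) : ReachIn G S a a :=
  Relation.ReflTransGen.refl

theorem ReachIn.single {V : Type*} {G : SimpleGraph V} {S : Set V} {a b : V} (h : G.Adj a b)
    (ha : a ∈ S) (hb : b ∈ S) : ReachIn G S a b :=
  Relation.ReflTransGen.single ⟨h, ha, hb⟩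

theorem ReachIn.trans {V : Type*} {G : SimpleGraph V} {S : Set V} {a b c : V}
    (h : ReachIn G S a b) (h' : ReachIn G S b c) : ReachIn G S a c :=
  Relation.ReflTransGen.trans h h'

theorem ReachIn.symm {V : Type*} {G : SimpleGraph V} {S : Set V} {a b : V}
    (h : ReachIn G S a b) : ReachIn G S b a := by
  induction h with
  | refl => exact ReachIn.refl _
  | tail _ h ih => exact (ReachIn.single h.1.symm h.2.2 h.2.1).trans ih

theorem ReachIn.mono {V : Type*} {G : SimpleGraph V} {S T : Set V} (hST : S ⊆ T) {a b : V}
    (h : ReachIn G S a b) : ReachIn G T a b :=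
  Relation.ReflTransGen.mono (fun _ _ h => ⟨h.1, hST h.2.1, hST h.2.2⟩) _ _ h

/-- The trivial walk of `ReachIn` says nothing about membership in `S`, so `a ∈ S` has to be
supplied. -/
theorem ReachIn.reachable_induce {V : Type*} {G : SimpleGraph V} {S : Set V} {a b : V}
    (h : ReachIn G S a b) (ha : a ∈ S) : ∃ hb : b ∈ S, (G.induce S).Reachable ⟨a, ha⟩ ⟨b, hb⟩ := by
  induction h with
  | refl => exact ⟨ha, Reachable.refl _⟩
  | tail _ h ih =>
    obtain ⟨hb, h1⟩ := ih
    exact ⟨h.2.2, h1.trans (Adj.reachable (by simpa using h.1))⟩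

theorem preconnected_induce_of_reachIn {V : Type*} {G : SimpleGraph V} {S : Set V}
    (h : ∀ a ∈ S, ∀ b ∈ S, ReachIn G S a b) : (G.induce S).Preconnected := by
  rintro ⟨a, ha⟩ ⟨b, hb⟩
  exact ((h a ha b hb).reachable_induce ha).2

/-- A walk in `S` from a vertex of `A` to a vertex outside `A` leaves `A` along an edge. -/
theorem ReachIn.exists_adj_boundary {V : Type*} {G : SimpleGraph V} {S A : Set V} {a b : V}
    (h : ReachIn G S a b) (ha : a ∈ A) (hb : b ∉ A) :
    ∃ x y, G.Adj x y ∧ x ∈ S ∧ x ∈ A ∧ y ∉ A := by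
  induction h with
  | refl => exact absurd ha hb
  | @tail c d _ h ih =>
    by_cases hc : c ∈ A
    · exact ⟨c, d, h.1, h.2.1, hc, hb⟩
    · exact ih hc

/-! ### Vertex sets with few outside neighbourhoods -/

/-- The vertices of `A` can be labelled with `k` labels in such a way that vertices with the same
label have the same neighbours outside `A`. -/
def IsLabelled {U : Type*} (k : ℕ) (Γ : SimpleGraph U) (A : Set U) : Prop :=
  ∃ a : A → Fin k, ∀ x x' : A, a x = a x' → ∀ y ∉ A, Γ.Adj x y ↔ Γ.Adj x' y

/-- For `x ∈ A` and `y ∉ A` the two are distinct, so complementation merely negates adjacency. This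
is what makes one lower bound serve both the walls and their complements. -/
theorem IsLabelled.of_compl {U : Type*} {k : ℕ} {Γ : SimpleGraph U} {A : Set U}
    (h : IsLabelled k Γᶜ A) : IsLabelled k Γ A := by
  obtain ⟨a, ha⟩ := h
  refine ⟨a, fun x x' hx y hy => ?_⟩
  have h1 := ha x x' hx y hy
  have h2 : (x : U) ≠ y := fun h => hy (h ▸ x.2)
  have h3 : (x' : U) ≠ y := fun h => hy (h ▸ x'.2)
  simp only [compl_adj, h2, h3, ne_eq, not_false_eq_true, true_and] at h1
  exact not_iff_not.1 h1

theorem isLabelled_range {U V : Type*} {k : ℕ} {Γ : SimpleGraph U} {ι : V → U}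
    (hι : Function.Injective ι) (a : V → Fin k)
    (h : ∀ x x', a x = a x' → ∀ y ∉ Set.range ι, Γ.Adj (ι x) y ↔ Γ.Adj (ι x') y) :
    IsLabelled k Γ (Set.range ι) := by
  refine ⟨fun x => a ((Equiv.ofInjective ι hι).symm x), fun x x' hx y hy => ?_⟩
  have := h _ _ hx y hy
  rwa [Equiv.apply_ofInjective_symm hι, Equiv.apply_ofInjective_symm hι] at this

/-- If a property of vertex sets fails for singletons, and passes from a union of two disjoint sets
to one of the two whenever all three sets are `k`-labelled, then it fails for the set of all
vertices of a graph that is constructible with `k` labels. Here this is stated for all stages of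
the construction: `R` tells which pairs of labels still have to be joined. -/
theorem Constructible.not_range {U : Type} {k : ℕ} {Γ : SimpleGraph U} {Φ : Set U → Prop}
    (h1 : ∀ x, ¬ Φ {x})
    (h2 : ∀ A B, IsLabelled k Γ A → IsLabelled k Γ B → IsLabelled k Γ (A ∪ B) →
      Φ (A ∪ B) → Φ A ∨ Φ B)
    {V : Type} {G : SimpleGraph V} {a : V → Fin k} (hc : Constructible k V G a) :
    ∀ (ι : V → U) (_ : Function.Injective ι) (R : Fin k → Fin k → Prop),
      (∀ x x', a x = a x' → ∀ y ∉ Set.range ι, Γ.Adj (ι x) y ↔ Γ.Adj (ι x') y) →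
      (∀ x y, x ≠ y → (Γ.Adj (ι x) (ι y) ↔ G.Adj x y ∨ R (a x) (a y))) →
      ¬ Φ (Set.range ι) := by
  -- The invariants: later operations cannot distinguish vertices that share a label, so these agree
  -- outside the image; and an edge of `Γ` inside the image is either already present or will be
  -- added later because of its two labels, as recorded by `R`.
  induction hc with
  | vertex i =>
    intro ι _ R _ _
    have : Set.range ι = {ι ()} := Set.range_unique
    rw [this]
    exact h1 _
  | @union V W G H a b _ _ ihV ihW =>
    intro ι hι R hout hin hΦ
    have hV : Function.Injective (ι ∘ Sum.inl) := hι.comp Sum.inl_injective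
    have hW : Function.Injective (ι ∘ Sum.inr) := hι.comp Sum.inr_injective
    have hun : Set.range ι = Set.range (ι ∘ Sum.inl) ∪ Set.range (ι ∘ Sum.inr) := by
      ext u; simp
    have houtV : ∀ x x', a x = a x' → ∀ y ∉ Set.range (ι ∘ Sum.inl),
        Γ.Adj (ι (Sum.inl x)) y ↔ Γ.Adj (ι (Sum.inl x')) y := by
      intro x x' hx y hy
      by_cases hy' : y ∈ Set.range ι
      · obtain ⟨z | z, rfl⟩ := hy'
        · exact absurd ⟨z, rfl⟩ hy
        -- The other summand sends no edges here yet, so adjacency to `y` is decided by `R` on the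
        -- labels alone.
        · rw [hin _ _ (by simp), hin _ _ (by simp)]
          simp [hx]
      · exact hout (Sum.inl x) (Sum.inl x') hx y hy'
    have houtW : ∀ x x', b x = b x' → ∀ y ∉ Set.range (ι ∘ Sum.inr),
        Γ.Adj (ι (Sum.inr x)) y ↔ Γ.Adj (ι (Sum.inr x')) y := by
      intro x x' hx y hy
      by_cases hy' : y ∈ Set.range ι
      · obtain ⟨z | z, rfl⟩ := hy'
        · rw [hin _ _ (by simp), hin _ _ (by simp)]
          simp [hx]
        · exact absurd ⟨z, rfl⟩ hy
      · exact hout (Sum.inr x) (Sum.inr x') hx y hy'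
    rw [hun] at hΦ
    rcases h2 _ _ (isLabelled_range hV a houtV) (isLabelled_range hW b houtW)
      (hun ▸ isLabelled_range hι _ hout) hΦ with h | h
    · refine ihV _ hV R houtV (fun x y hxy => ?_) h
      have := hin (Sum.inl x) (Sum.inl y) (by simpa using hxy)
      simpa using this
    · refine ihW _ hW R houtW (fun x y hxy => ?_) h
      have := hin (Sum.inr x) (Sum.inr y) (by simpa using hxy)
      simpa using this
  | @join V G a i j _ _ ih =>
    intro ι hι R hout hin
    -- Before the join, its edges still lie in the future and are therefore moved into `R`.
    refine ih ι hι (fun p q => R p q ∨ (p = i ∧ q = j) ∨ (q = i ∧ p = j)) hout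
      (fun x y hxy => ?_)
    rw [hin x y hxy, sup_adj, fromRel_adj]
    tauto
  | @relabel V G a i j _ ih =>
    intro ι hι R hout hin
    refine ih ι hι (fun p q => R (if p = i then j else p) (if q = i then j else q))
      (fun x x' hx => hout x x' (by simp [hx])) hin
  | @iso V W G H a e _ ih =>
    intro ι hι R hout hin
    have hr : Set.range (ι ∘ e) = Set.range ι := e.surjective.range_comp ι
    rw [← hr]
    refine ih (ι ∘ e) (hι.comp e.injective) R ?_ ?_
    · intro x x' hx y hy
      rw [hr] at hy
      exact hout (e x) (e x') (by simpa using hx) y hy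
    · intro x y hxy
      have := hin (e x) (e y) (by simpa using hxy)
      simpa [e.map_adj_iff] using this

theorem Constructible.not_univ {U : Type} {k : ℕ} {Γ : SimpleGraph U} {Φ : Set U → Prop}
    (h1 : ∀ x, ¬ Φ {x})
    (h2 : ∀ A B, IsLabelled k Γ A → IsLabelled k Γ B → IsLabelled k Γ (A ∪ B) →
      Φ (A ∪ B) → Φ A ∨ Φ B)
    {a : U → Fin k} (hc : Constructible k U Γ a) : ¬ Φ Set.univ := by
  -- The construction is finished: nothing is left to join, and no vertex lies outside.
  have := hc.not_range h1 h2 id Function.injective_id (fun _ _ => False)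
    (by simp) (by simp)
  simpa using this

/-- In a graph of maximum degree at most `3`, a `k`-labelled set splits at most `3k` of any
family of disjoint connected sets. -/
theorem IsLabelled.card_split_le {U ι : Type*} [Finite U] {k : ℕ} {Γ : SimpleGraph U} {A : Set U}
    (hA : IsLabelled k Γ A) (hdeg : ∀ u, (Γ.neighborSet u).ncard ≤ 3) (S : ι → Set U)
    (hdisj : Pairwise fun i j => Disjoint (S i) (S j))
    (hconn : ∀ i, ∀ x ∈ S i, ∀ y ∈ S i, ReachIn Γ (S i) x y) (t : Finset ι)
    (ht : ∀ i ∈ t, (∃ x ∈ S i, x ∈ A) ∧ ∃ x ∈ S i, x ∉ A) : t.card ≤ 3 * k := by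
  classical
  obtain ⟨a, ha⟩ := hA
  -- A split connected set has an edge that leaves `A`; its end `b i` in `A` represents the set.
  have hb : ∀ i : t, ∃ x y, Γ.Adj x y ∧ x ∈ S i ∧ x ∈ A ∧ y ∉ A := by
    rintro ⟨i, hi⟩
    obtain ⟨⟨x, hx, hxA⟩, y, hy, hyA⟩ := ht i hi
    exact (hconn i x hx y hy).exists_adj_boundary hxA hyA
  choose b y hadj hbS hbA hyA using hb
  have hinj : Function.Injective b := by
    intro i j hij
    by_contra hne
    exact Set.disjoint_left.1 (hdisj (fun h => hne (Subtype.ext h))) (hbS i) (hij ▸ hbS j)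
  have key := Finset.card_le_mul_card_image_of_maps_to
    (f := fun i : t => a ⟨b i, hbA i⟩) (s := Finset.univ) (t := Finset.univ)
    (fun _ _ => Finset.mem_univ _) 3 (by
      intro l _
      rcases (Finset.univ.filter fun i : t => a ⟨b i, hbA i⟩ = l).eq_empty_or_nonempty with h | h
      · rw [h]; simp
      · obtain ⟨i₀, hi₀⟩ := h
        rw [← Set.ncard_coe_finset]
        -- All representatives with one label share the outside neighbour `y i₀`, so there are at
        -- most three of them per label.
        refine le_trans ?_ (hdeg (y i₀))
        refine Set.ncard_le_ncard_of_injOn b ?_ hinj.injOn (Set.toFinite _)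
        intro i hi
        simp only [Finset.coe_filter, Finset.mem_univ, true_and, Set.mem_ofPred_eq,
          Finset.mem_filter] at hi hi₀
        exact ((ha ⟨b i, hbA i⟩ ⟨b i₀, hbA i₀⟩ (hi.trans hi₀.symm) (y i₀) (hyA i₀)).2
          (hadj i₀)).symm)
  simpa using key

/-- The maximum degree is at most `3`, and there are `r` disjoint connected rows, each of which
meets each of `r` disjoint connected columns. -/
structure HasGrid {U : Type*} (r : ℕ) (Γ : SimpleGraph U) : Prop where
  degree_le : ∀ u, (Γ.neighborSet u).ncard ≤ 3
  exists_rows : ∃ R C : Fin r → Set U,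
    (Pairwise fun i j => Disjoint (R i) (R j)) ∧ (Pairwise fun i j => Disjoint (C i) (C j)) ∧
    (∀ i, ∀ x ∈ R i, ∀ y ∈ R i, ReachIn Γ (R i) x y) ∧
    (∀ i, ∀ x ∈ C i, ∀ y ∈ C i, ReachIn Γ (C i) x y) ∧
    (∀ i j, (R i ∩ C j).Nonempty) ∧ ∀ i, (R i).Nontrivial

/-- If `A` and `B` contain no whole row, then each row that meets one of them is split by it. That
accounts for at most `3k + 3k` rows, so some row avoids `A ∪ B`. A row inside `A ∪ B` would then
make `A ∪ B` split every column. -/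
theorem HasGrid.exists_big {U : Type*} [Finite U] {r k : ℕ} {Γ : SimpleGraph U}
    (hΓ : HasGrid r Γ) (hr : 6 * k < r) :
    ∃ Φ : Set U → Prop, (∀ x, ¬ Φ {x}) ∧ Φ Set.univ ∧
      ∀ A B, IsLabelled k Γ A → IsLabelled k Γ B → IsLabelled k Γ (A ∪ B) →
        Φ (A ∪ B) → Φ A ∨ Φ B := by
  classical
  obtain ⟨hdeg, R, C, hR, hC, hRc, hCc, hRC, hnt⟩ := hΓ
  refine ⟨fun A => ∃ i, R i ⊆ A, ?_, ⟨⟨0, by omega⟩, Set.subset_univ _⟩, ?_⟩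
  · rintro x ⟨i, hi⟩
    exact (hnt i).not_subset_singleton hi
  rintro A B hA hB hAB ⟨i₀, hi₀⟩
  by_contra! hcon
  obtain ⟨hnA, hnB⟩ := hcon
  have hcard : ∀ D, IsLabelled k Γ D → (∀ i, ¬ R i ⊆ D) →
      (Finset.univ.filter fun i => ∃ x ∈ R i, x ∈ D).card ≤ 3 * k := by
    intro D hD hnD
    refine hD.card_split_le hdeg R hR hRc _ (fun i hi => ⟨(Finset.mem_filter.1 hi).2, ?_⟩)
    simpa [Set.not_subset] using hnD i
  have h1 := hcard A hA hnA
  have h2 := hcard B hB hnB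
  obtain ⟨i, hi⟩ : ∃ i, i ∉ (Finset.univ.filter fun i => ∃ x ∈ R i, x ∈ A) ∪
      (Finset.univ.filter fun i => ∃ x ∈ R i, x ∈ B) := by
    by_contra! hall
    have h3 := Finset.card_union_le (Finset.univ.filter fun i => ∃ x ∈ R i, x ∈ A)
      (Finset.univ.filter fun i => ∃ x ∈ R i, x ∈ B)
    rw [Finset.eq_univ_iff_forall.2 hall, Finset.card_univ, Fintype.card_fin] at h3
    omega
  -- Each column meets row `i₀` inside `A ∪ B` and row `i` outside it.
  have h4 := hAB.card_split_le hdeg C hC hCc Finset.univ (by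
    intro j _
    obtain ⟨x, hxR, hxC⟩ := hRC i₀ j
    obtain ⟨y, hyR, hyC⟩ := hRC i j
    refine ⟨⟨x, hxC, hi₀ hxR⟩, y, hyC, fun hy => hi ?_⟩
    simp only [Finset.mem_union, Finset.mem_filter, Finset.mem_univ, true_and]
    exact hy.imp (fun h => ⟨y, hyR, h⟩) (fun h => ⟨y, hyR, h⟩))
  rw [Finset.card_univ, Fintype.card_fin] at h4
  omega

/-- The infimum is attained because it is taken over a nonempty set; otherwise `sInf` would return
the default value `0`. -/
theorem exists_constructible_cliqueWidth {V : Type} [Finite V] [Nonempty V] (G : SimpleGraph V) :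
    ∃ a : V → Fin (cliqueWidth G), Constructible (cliqueWidth G) V G a :=
  Nat.sInf_mem (s := {k : ℕ | ∃ a : V → Fin k, Constructible k V G a}) (exists_constructible G)

theorem HasGrid.nonempty {U : Type*} {r : ℕ} {Γ : SimpleGraph U} (hΓ : HasGrid r Γ)
    (hr : 0 < r) : Nonempty U := by
  obtain ⟨_, R, C, _, _, _, _, _, hnt⟩ := hΓ
  exact (hnt ⟨0, hr⟩).nonempty.to_type

/-- A clique-width `k ≤ c` satisfies `6 * k < 6 * c + 1`. For `Γᶜ` the grid and the degree bound are
still those of `Γ`; only the labellings are transferred. -/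
theorem HasGrid.lt_cliqueWidth {U : Type} [Finite U] {c : ℕ} {Γ : SimpleGraph U}
    (hΓ : HasGrid (6 * c + 1) Γ) : c < cliqueWidth Γ ∧ c < cliqueWidth Γᶜ := by
  have := hΓ.nonempty (by omega)
  constructor
  · by_contra! hc
    obtain ⟨a, ha⟩ := exists_constructible_cliqueWidth Γ
    obtain ⟨Φ, h1, h2, h3⟩ := hΓ.exists_big (k := cliqueWidth Γ) (by omega)
    exact ha.not_univ h1 h3 h2
  · by_contra! hc
    obtain ⟨a, ha⟩ := exists_constructible_cliqueWidth Γᶜ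
    obtain ⟨Φ, h1, h2, h3⟩ := hΓ.exists_big (k := cliqueWidth Γᶜ) (by omega)
    exact ha.not_univ h1
      (fun A B hA hB hAB => h3 A B hA.of_compl hB.of_compl hAB.of_compl) h2

end AtomsCW
namespace AtomsCW

/-! ### Subdivisions -/

section Subdivision

variable {V : Type} {k : ℕ} {G : SimpleGraph V}

/-- The first end of an edge, in the order chosen in `subdivision`. -/
noncomputable def edgeFst (e : G.edgeSet) : V := (Quot.out e.val).1

/-- The second end of an edge, in the order chosen in `subdivision`. -/
noncomputable def edgeSnd (e : G.edgeSet) : V := (Quot.out e.val).2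

theorem mk_edgeFst_edgeSnd (e : G.edgeSet) : s(edgeFst e, edgeSnd e) = e.val :=
  Quot.out_eq e.val

theorem adj_edgeFst_edgeSnd (e : G.edgeSet) : G.Adj (edgeFst e) (edgeSnd e) := by
  rw [← mem_edgeSet, mk_edgeFst_edgeSnd]
  exact e.2

theorem edge_eq_iff {e f : G.edgeSet} : e = f ↔
    (edgeFst e = edgeFst f ∧ edgeSnd e = edgeSnd f) ∨
      (edgeFst e = edgeSnd f ∧ edgeSnd e = edgeFst f) := by
  rw [Subtype.ext_iff, ← mk_edgeFst_edgeSnd e, ← mk_edgeFst_edgeSnd f, Sym2.eq_iff]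

theorem subdivision_adj_inl_inl (hk : 1 ≤ k) (u v : V) :
    ¬ (subdivision k G).Adj (Sum.inl u) (Sum.inl v) := by
  simp only [subdivision, fromRel_adj]
  omega

theorem subdivision_adj_inl_inr (u : V) (e : G.edgeSet) (p : Fin k) :
    (subdivision k G).Adj (Sum.inl u) (Sum.inr (e, p)) ↔
      (u = edgeFst e ∧ p.val = 0) ∨ (u = edgeSnd e ∧ p.val + 1 = k) := by
  simp [subdivision, fromRel_adj, edgeFst, edgeSnd]

theorem subdivision_adj_inr_inl (u : V) (e : G.edgeSet) (p : Fin k) :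
    (subdivision k G).Adj (Sum.inr (e, p)) (Sum.inl u) ↔
      (u = edgeFst e ∧ p.val = 0) ∨ (u = edgeSnd e ∧ p.val + 1 = k) := by
  rw [adj_comm, subdivision_adj_inl_inr]

theorem subdivision_adj_inr_inr (e f : G.edgeSet) (p q : Fin k) :
    (subdivision k G).Adj (Sum.inr (e, p)) (Sum.inr (f, q)) ↔
      e = f ∧ (p.val + 1 = q.val ∨ q.val + 1 = p.val) := by
  simp only [subdivision, fromRel_adj, ne_eq, Sum.inr.injEq, Prod.mk.injEq, not_and]
  constructor
  · rintro ⟨_, ⟨rfl, h⟩ | ⟨rfl, h⟩⟩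
    · exact ⟨rfl, Or.inl h⟩
    · exact ⟨rfl, Or.inr h⟩
  · rintro ⟨rfl, h⟩
    refine ⟨fun _ h' => ?_, h.imp (fun h => ⟨rfl, h⟩) (fun h => ⟨rfl, h⟩)⟩
    subst h'
    omega

/-! #### Walks along subdivided edges -/

theorem reachIn_edgeFst {S : Set (V ⊕ (G.edgeSet × Fin k))} (e : G.edgeSet) (q : Fin k)
    (h : Sum.inl (edgeFst e) ∈ S) (hS : ∀ p ≤ q, Sum.inr (e, p) ∈ S) :
    ReachIn (subdivision k G) S (Sum.inl (edgeFst e)) (Sum.inr (e, q)) := by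
  obtain ⟨q, hq⟩ := q
  induction q with
  | zero => exact ReachIn.single ((subdivision_adj_inl_inr _ _ _).2 (by simp)) h (hS _ le_rfl)
  | succ q ih =>
    have hlt : (⟨q, by omega⟩ : Fin k) ≤ ⟨q + 1, hq⟩ := by simp
    refine (ih (by omega) (fun p hp => hS p (hp.trans hlt))).trans (ReachIn.single ?_
      (hS _ hlt) (hS _ le_rfl))
    exact (subdivision_adj_inr_inr _ _ _ _).2 (by simp)

theorem reachIn_edgeSnd {S : Set (V ⊕ (G.edgeSet × Fin k))} (e : G.edgeSet) (q : Fin k)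
    (h : Sum.inl (edgeSnd e) ∈ S) (hS : ∀ p, q ≤ p → Sum.inr (e, p) ∈ S) :
    ReachIn (subdivision k G) S (Sum.inr (e, q)) (Sum.inl (edgeSnd e)) := by
  -- Induction on the number `m` of inner vertices between position `q` and the second end.
  obtain ⟨m, hm⟩ : ∃ m, q.val + m + 1 = k := ⟨k - 1 - q.val, by omega⟩
  induction m generalizing q with
  | zero =>
    exact ReachIn.single ((subdivision_adj_inr_inl _ _ _).2 (Or.inr ⟨rfl, by omega⟩))
      (hS _ le_rfl) h
  | succ m ih =>
    have hlt : q ≤ (⟨q.val + 1, by omega⟩ : Fin k) := by simp [Fin.le_def]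
    refine ReachIn.trans (ReachIn.single ?_ (hS _ le_rfl) (hS _ hlt)) (ih ⟨q.val + 1, by omega⟩
      (fun p hp => hS p (hlt.trans hp)) (by simp only; omega))
    exact (subdivision_adj_inr_inr _ _ _ _).2 (by simp)

/-- A walk of `G` gives a walk in the subdivision that stays inside `S`, provided that `S` contains
all of the subdivided edges of the walk. -/
theorem reachIn_inl (hk : 1 ≤ k) {S : Set (V ⊕ (G.edgeSet × Fin k))} {r : V → V → Prop}
    (hr : ∀ a b, r a b → ∃ h : G.Adj a b, Sum.inl a ∈ S ∧ Sum.inl b ∈ S ∧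
      ∀ p, Sum.inr (⟨s(a, b), h⟩, p) ∈ S) {a b : V} (h : Relation.ReflTransGen r a b) :
    ReachIn (subdivision k G) S (Sum.inl a) (Sum.inl b) := by
  induction h with
  | refl => exact ReachIn.refl _
  | @tail b c _ hbc ih =>
    refine ih.trans ?_
    obtain ⟨hadj, hb, hc, hp⟩ := hr b c hbc
    have hends := mk_edgeFst_edgeSnd (⟨s(b, c), hadj⟩ : G.edgeSet)
    rw [Sym2.eq_iff] at hends
    have h1 : Sum.inl (edgeFst (⟨s(b, c), hadj⟩ : G.edgeSet)) ∈ S := by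
      rcases hends with ⟨h, _⟩ | ⟨h, _⟩ <;> rwa [h]
    have h2 : Sum.inl (edgeSnd (⟨s(b, c), hadj⟩ : G.edgeSet)) ∈ S := by
      rcases hends with ⟨_, h⟩ | ⟨_, h⟩ <;> rwa [h]
    have h3 := (reachIn_edgeFst _ ⟨0, hk⟩ h1 (fun p _ => hp p)).trans
      (reachIn_edgeSnd _ ⟨0, hk⟩ h2 (fun p _ => hp p))
    rcases hends with ⟨h, h'⟩ | ⟨h, h'⟩
    · rwa [h, h'] at h3
    · rw [h, h'] at h3
      exact h3.symm

/-- The vertices of the subdivision that lie on edges of `G` inside `S`. -/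
def subdivisionLift (k : ℕ) (G : SimpleGraph V) (S : Set V) : Set (V ⊕ (G.edgeSet × Fin k)) :=
  {x | Sum.elim (· ∈ S) (fun ep => edgeFst ep.1 ∈ S ∧ edgeSnd ep.1 ∈ S) x}

theorem inr_mem_subdivisionLift {S : Set V} {e : G.edgeSet} {p : Fin k} :
    Sum.inr (e, p) ∈ subdivisionLift k G S ↔ edgeFst e ∈ S ∧ edgeSnd e ∈ S := Iff.rfl

theorem subdivisionLift_disjoint {S T : Set V} (h : Disjoint S T) :
    Disjoint (subdivisionLift k G S) (subdivisionLift k G T) := by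
  rw [Set.disjoint_left] at h ⊢
  rintro (u | ⟨e, p⟩) h1 h2
  · exact h h1 h2
  · exact h h1.1 h2.1

theorem reachIn_subdivisionLift (hk : 1 ≤ k) {S : Set V}
    (h : ∀ x ∈ S, ∀ y ∈ S, ReachIn G S x y) :
    ∀ x ∈ subdivisionLift k G S, ∀ y ∈ subdivisionLift k G S,
      ReachIn (subdivision k G) (subdivisionLift k G S) x y := by
  have h1 : ∀ x ∈ S, ∀ y ∈ S,
      ReachIn (subdivision k G) (subdivisionLift k G S) (Sum.inl x) (Sum.inl y) := by
    intro x hx y hy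
    refine reachIn_inl hk ?_ (h x hx y hy)
    rintro a b ⟨hab, ha, hb⟩
    refine ⟨hab, ha, hb, fun p => inr_mem_subdivisionLift.2 ?_⟩
    have hends := mk_edgeFst_edgeSnd (⟨s(a, b), hab⟩ : G.edgeSet)
    rw [Sym2.eq_iff] at hends
    rcases hends with ⟨h, h'⟩ | ⟨h, h'⟩ <;> rw [h, h'] <;> simp [ha, hb]
  have h2 : ∀ x ∈ subdivisionLift k G S, ∃ u ∈ S,
      ReachIn (subdivision k G) (subdivisionLift k G S) x (Sum.inl u) := by
    rintro (u | ⟨e, p⟩) hx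
    · exact ⟨u, hx, ReachIn.refl _⟩
    · exact ⟨edgeSnd e, hx.2, reachIn_edgeSnd e p hx.2 (fun q _ => hx)⟩
  intro x hx y hy
  obtain ⟨u, hu, hxu⟩ := h2 x hx
  obtain ⟨v, hv, hyv⟩ := h2 y hy
  exact (hxu.trans (h1 u hu v hv)).trans hyv.symm

/-! #### Degrees -/

theorem subdivision_ncard_neighborSet_inr_le (e : G.edgeSet) (p : Fin k) :
    ((subdivision k G).neighborSet (Sum.inr (e, p))).ncard ≤ 2 := by
  let x : V ⊕ (G.edgeSet × Fin k) :=
    if p.val = 0 then Sum.inl (edgeFst e) else Sum.inr (e, ⟨p.val - 1, by omega⟩)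
  let y : V ⊕ (G.edgeSet × Fin k) :=
    if h : p.val + 1 = k then Sum.inl (edgeSnd e) else Sum.inr (e, ⟨p.val + 1, by omega⟩)
  refine le_trans (Set.ncard_le_ncard (t := {x, y}) ?_ (Set.toFinite _))
    ((Set.ncard_insert_le _ _).trans (by simp))
  rintro (u | ⟨f, q⟩) h
  · rw [mem_neighborSet, subdivision_adj_inr_inl] at h
    rcases h with ⟨rfl, h⟩ | ⟨rfl, h⟩
    · left; simp [x, h]
    · right; simp [y, h]
  · rw [mem_neighborSet, subdivision_adj_inr_inr] at h
    obtain ⟨rfl, h | h⟩ := h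
    · right
      have : q.val ≠ k := by omega
      simp [y, h, this]
    · left
      have : p.val ≠ 0 := by omega
      simp only [x, this, if_false, Sum.inr.injEq, Prod.mk.injEq, Fin.ext_iff, true_and]
      omega

/-- Sending a neighbour of `u` on a subdivided edge to the other end of that edge is injective: the
two ends determine the edge, and the end at which `u` sits determines the position. -/
theorem subdivision_ncard_neighborSet_inl_le [Finite V] (hk : 1 ≤ k) (u : V) :
    ((subdivision k G).neighborSet (Sum.inl u)).ncard ≤ (G.neighborSet u).ncard := by
  classical
  let φ : V ⊕ (G.edgeSet × Fin k) → V :=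
    Sum.elim id (fun ep => if edgeFst ep.1 = u then edgeSnd ep.1 else edgeFst ep.1)
  refine Set.ncard_le_ncard_of_injOn φ ?_ ?_ (Set.toFinite _)
  · rintro (v | ⟨e, p⟩) h
    · exact absurd h (subdivision_adj_inl_inl hk u v)
    · rw [mem_neighborSet, subdivision_adj_inl_inr] at h
      have hadj := adj_edgeFst_edgeSnd e
      rcases h with ⟨rfl, h⟩ | ⟨rfl, h⟩
      · simpa [φ] using hadj
      · simpa [φ, hadj.ne] using hadj.symm
  · rintro (v | ⟨e, p⟩) h (w | ⟨f, q⟩) h' heq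
    · exact absurd h (subdivision_adj_inl_inl hk u v)
    · exact absurd h (subdivision_adj_inl_inl hk u v)
    · exact absurd h' (subdivision_adj_inl_inl hk u w)
    · rw [mem_neighborSet, subdivision_adj_inl_inr] at h h'
      have he := (adj_edgeFst_edgeSnd e).ne
      have hf := (adj_edgeFst_edgeSnd f).ne
      have hef : e = f := by
        rw [edge_eq_iff]
        simp only [φ, Sum.elim_inr] at heq
        grind
      subst hef
      have hpq : p = q := by
        rw [Fin.ext_iff]
        rcases h with ⟨h, _⟩ | ⟨h, _⟩ <;> rcases h' with ⟨h', _⟩ | ⟨h', _⟩ <;>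
          first | omega | exact absurd (h.symm.trans h') he | exact absurd (h'.symm.trans h) he
      rw [hpq]

theorem subdivision_ncard_neighborSet_le [Finite V] (hk : 1 ≤ k)
    (hdeg : ∀ u, (G.neighborSet u).ncard ≤ 3) (x : V ⊕ (G.edgeSet × Fin k)) :
    ((subdivision k G).neighborSet x).ncard ≤ 3 := by
  rcases x with u | ⟨e, p⟩
  · exact (subdivision_ncard_neighborSet_inl_le hk u).trans (hdeg u)
  · exact (subdivision_ncard_neighborSet_inr_le e p).trans (by omega)

theorem HasGrid.subdivision [Finite V] {r : ℕ} (hk : 1 ≤ k) (h : HasGrid r G) :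
    HasGrid r (subdivision k G) := by
  obtain ⟨hdeg, R, C, hR, hC, hRc, hCc, hRC, hnt⟩ := h
  refine ⟨subdivision_ncard_neighborSet_le hk hdeg, fun i => subdivisionLift k G (R i),
    fun i => subdivisionLift k G (C i), fun i j hij => subdivisionLift_disjoint (hR hij),
    fun i j hij => subdivisionLift_disjoint (hC hij),
    fun i => reachIn_subdivisionLift hk (hRc i), fun i => reachIn_subdivisionLift hk (hCc i),
    fun i j => ?_, fun i => ?_⟩
  · obtain ⟨x, hx, hx'⟩ := hRC i j
    exact ⟨Sum.inl x, hx, hx'⟩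
  · obtain ⟨x, hx, y, hy, hxy⟩ := hnt i
    exact ⟨Sum.inl x, hx, Sum.inl y, hy, by simpa using hxy⟩

/-! #### Atoms -/

/-- If deleting any vertex of `G` leaves a connected graph, then so does deleting any edge. -/
theorem reflTransGen_adj_ne_edge (h2 : ∀ u a b, a ≠ u → b ≠ u → ReachIn G {u}ᶜ a b)
    (h3 : ∀ u v : V, ∃ w, w ≠ u ∧ w ≠ v) (e : G.edgeSet) (a b : V) :
    Relation.ReflTransGen (fun a b => G.Adj a b ∧ s(a, b) ≠ e.val) a b := by
  -- A walk that avoids an end of `e` cannot use `e`.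
  have key : ∀ u ∈ e.val, ∀ a b, a ≠ u → b ≠ u →
      Relation.ReflTransGen (fun a b => G.Adj a b ∧ s(a, b) ≠ e.val) a b := by
    intro u hu a b ha hb
    refine Relation.ReflTransGen.mono (fun x y h => ⟨h.1, fun hxy => ?_⟩) _ _ (h2 u a b ha hb)
    rw [← hxy, Sym2.mem_iff] at hu
    rcases hu with hu | hu
    · exact h.2.1 hu.symm
    · exact h.2.2 hu.symm
  -- The vertex `w` serves as a hub: the first end of `e` reaches it avoiding the second end, and
  -- every other vertex reaches it avoiding the first.
  obtain ⟨w, hw1, hw2⟩ := h3 (edgeFst e) (edgeSnd e)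
  have hne := (adj_edgeFst_edgeSnd e).ne
  have hm1 : edgeFst e ∈ e.val := by rw [← mk_edgeFst_edgeSnd e]; simp
  have hm2 : edgeSnd e ∈ e.val := by rw [← mk_edgeFst_edgeSnd e]; simp
  have hw : ∀ c, Relation.ReflTransGen (fun a b => G.Adj a b ∧ s(a, b) ≠ e.val) c w ∧
      Relation.ReflTransGen (fun a b => G.Adj a b ∧ s(a, b) ≠ e.val) w c := by
    intro c
    by_cases hc : c = edgeFst e
    · subst hc
      exact ⟨key _ hm2 _ _ hne hw2, key _ hm2 _ _ hw2 hne⟩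
    · exact ⟨key _ hm1 _ _ hc hw1, key _ hm1 _ _ hw1 hc⟩
  exact (hw a).1.trans (hw b).2

/-- If deleting any vertex of `G` leaves a connected graph, then its subdivisions are atoms. -/
theorem subdivision_isAtom (hk : 1 ≤ k) (h2 : ∀ u a b, a ≠ u → b ≠ u → ReachIn G {u}ᶜ a b)
    (h3 : ∀ u v : V, ∃ w, w ≠ u ∧ w ≠ v) [Nonempty G.edgeSet] : IsAtom (subdivision k G) := by
  rintro K ⟨hK, hcut⟩
  refine hcut (preconnected_induce_of_reachIn ?_)
  -- If `K` contains a branch vertex `u`, its other members are inner neighbours of `u`, and walks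
  -- of `G` avoiding `u` survive. Otherwise `K` lies inside one subdivided edge `e`, and walks of
  -- `G` avoiding `e` survive.
  by_cases hu : ∃ u, Sum.inl u ∈ K
  · obtain ⟨u, hu⟩ := hu
    have hadj : ∀ e p, Sum.inr (e, p) ∈ K →
        (u = edgeFst e ∧ p.val = 0) ∨ (u = edgeSnd e ∧ p.val + 1 = k) := by
      intro e p hp
      exact (subdivision_adj_inl_inr u e p).1 (hK hu hp (by simp))
    have hinl : ∀ v, Sum.inl v ∈ K → v = u := by
      intro v hv
      by_contra hne
      exact subdivision_adj_inl_inl hk v u (hK hv hu (by simpa using hne))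
    -- Walk along the subdivided edge towards an end other than `u`; a member of `K` on the way
    -- would be the last vertex before `u`, which forces it to be the starting vertex itself.
    have hends : ∀ x ∈ Kᶜ, ∃ v, v ≠ u ∧ ReachIn (subdivision k G) Kᶜ x (Sum.inl v) := by
      rintro (v | ⟨e, q⟩) hx
      · exact ⟨v, fun h => hx (h ▸ hu), ReachIn.refl _⟩
      · have hne := (adj_edgeFst_edgeSnd e).ne
        by_cases h : edgeSnd e = u
        · refine ⟨edgeFst e, fun h' => hne (h'.trans h.symm), (reachIn_edgeFst (S := Kᶜ) e q
            (fun h' => hne ((hinl _ h').trans h.symm)) (fun p hp hpK => ?_)).symm⟩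
          rcases hadj e p hpK with ⟨h', _⟩ | ⟨_, h'⟩
          · exact hne (h'.symm.trans h.symm)
          · have : p = q := le_antisymm hp (by rw [Fin.le_def]; omega)
            exact hx (this ▸ hpK)
        · refine ⟨edgeSnd e, h, reachIn_edgeSnd e q (fun h' => h (hinl _ h'))
            (fun p hp hpK => ?_)⟩
          rcases hadj e p hpK with ⟨_, h'⟩ | ⟨h', _⟩
          · have : p = q := le_antisymm (by rw [Fin.le_def]; omega) hp
            exact hx (this ▸ hpK)
          · exact h h'.symm
    intro x hx y hy
    obtain ⟨v, hv, hxv⟩ := hends x hx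
    obtain ⟨w, hw, hyw⟩ := hends y hy
    refine (hxv.trans (reachIn_inl hk ?_ (h2 u v w hv hw))).trans hyw.symm
    rintro a b ⟨hab, ha, hb⟩
    refine ⟨hab, fun h => ha (hinl a h), fun h => hb (hinl b h), fun p hp => ?_⟩
    have hends := mk_edgeFst_edgeSnd (⟨s(a, b), hab⟩ : G.edgeSet)
    have hmem : u ∈ s(a, b) := by
      rw [← show s(edgeFst _, edgeSnd _) = s(a, b) from hends, Sym2.mem_iff]
      exact (hadj _ p hp).imp (fun h => h.1) (fun h => h.1)
    rcases Sym2.mem_iff.1 hmem with h | h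
    · exact ha h.symm
    · exact hb h.symm
  · push Not at hu
    obtain ⟨e, he⟩ : ∃ e : G.edgeSet, ∀ f p, Sum.inr (f, p) ∈ K → f = e := by
      by_cases hne : ∃ e p, Sum.inr (e, p) ∈ K
      · obtain ⟨e, p, hp⟩ := hne
        refine ⟨e, fun f q hq => ?_⟩
        by_contra hfe
        exact hfe ((subdivision_adj_inr_inr f e q p).1 (hK hq hp (by simp [hfe]))).1
      · push Not at hne
        exact ⟨Classical.arbitrary _, fun f p hp => absurd hp (hne f p)⟩
    have hends : ∀ x ∈ Kᶜ, ∃ v, ReachIn (subdivision k G) Kᶜ x (Sum.inl v) := by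
      rintro (v | ⟨f, q⟩) hx
      · exact ⟨v, ReachIn.refl _⟩
      -- If both directions were blocked, `K` would have members on either side of `q`, and these
      -- are not adjacent.
      · by_cases hlow : ∀ p ≤ q, Sum.inr (f, p) ∉ K
        · exact ⟨_, (reachIn_edgeFst f q (hu _) hlow).symm⟩
        · push Not at hlow
          obtain ⟨p, hpq, hp⟩ := hlow
          refine ⟨_, reachIn_edgeSnd f q (hu _) (fun p' hp' hp'K => ?_)⟩
          have hpq' : p ≠ q := fun h => hx (h ▸ hp)
          have hpq'' : p' ≠ q := fun h => hx (h ▸ hp'K)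
          rw [Fin.le_def] at hpq hp'
          rw [ne_eq, Fin.ext_iff] at hpq' hpq''
          have := ((subdivision_adj_inr_inr f f p p').1 (hK hp hp'K (by
            simp only [ne_eq, Sum.inr.injEq, Prod.mk.injEq, true_and, Fin.ext_iff]
            omega))).2
          omega
    intro x hx y hy
    obtain ⟨v, hxv⟩ := hends x hx
    obtain ⟨w, hyw⟩ := hends y hy
    refine (hxv.trans (reachIn_inl hk ?_ (reflTransGen_adj_ne_edge h2 h3 e v w))).trans hyw.symm
    rintro a b ⟨hab, hne⟩
    exact ⟨hab, hu a, hu b, fun p hp => hne (congrArg Subtype.val (he _ p hp))⟩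

/-- This places a nonadjacent pair of the complement on a single edge of `G`. Quantifying over `z`
lets both vertices be treated at once. -/
theorem subdivision_exists_edge_of_adj (hk : 1 ≤ k) {x y : V ⊕ (G.edgeSet × Fin k)}
    (h : (subdivision k G).Adj x y) : ∃ e : G.edgeSet, ∀ z, (z = x ∨ z = y) →
      (∃ p, z = Sum.inr (e, p)) ∨ z = Sum.inl (edgeFst e) ∨ z = Sum.inl (edgeSnd e) := by
  rcases x with u | ⟨e, p⟩ <;> rcases y with v | ⟨f, q⟩
  · exact absurd h (subdivision_adj_inl_inl hk u v)
  · rw [subdivision_adj_inl_inr] at h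
    refine ⟨f, ?_⟩
    rintro z (rfl | rfl)
    · exact Or.inr (h.imp (fun h => by rw [h.1]) (fun h => by rw [h.1]))
    · exact Or.inl ⟨q, rfl⟩
  · rw [subdivision_adj_inr_inl] at h
    refine ⟨e, ?_⟩
    rintro z (rfl | rfl)
    · exact Or.inl ⟨p, rfl⟩
    · exact Or.inr (h.imp (fun h => by rw [h.1]) (fun h => by rw [h.1]))
  · rw [subdivision_adj_inr_inr] at h
    obtain ⟨rfl, _⟩ := h
    refine ⟨e, ?_⟩
    rintro z (rfl | rfl)
    · exact Or.inl ⟨p, rfl⟩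
    · exact Or.inl ⟨q, rfl⟩

/-- If for every edge of `G` there is an edge disjoint from it, then the complements of the
subdivisions of `G` are atoms. -/
theorem subdivision_compl_isAtom (hk : 1 ≤ k)
    (hdisj : ∀ e : G.edgeSet, ∃ f : G.edgeSet, ∀ u ∈ e.val, u ∉ f.val) :
    IsAtom (subdivision k G)ᶜ := by
  rintro K ⟨hK, hcut⟩
  refine hcut (preconnected_induce_of_reachIn ?_)
  intro x hx y hy
  by_cases hxy : x = y
  · subst hxy; exact ReachIn.refl _
  by_cases hadj : (subdivision k G).Adj x y
  · obtain ⟨e, he⟩ := subdivision_exists_edge_of_adj hk hadj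
    obtain ⟨f, hf⟩ := hdisj e
    have hf' : ∀ u, (u = edgeFst e ∨ u = edgeSnd e) → ¬ (u = edgeFst f ∨ u = edgeSnd f) := by
      intro u hu
      have := hf u (by rw [← mk_edgeFst_edgeSnd e, Sym2.mem_iff]; exact hu)
      rwa [← mk_edgeFst_edgeSnd f, Sym2.mem_iff] at this
    have hfe : f ≠ e := by
      rintro rfl
      exact hf' _ (Or.inl rfl) (Or.inl rfl)
    -- The first end of `f` and the first inner vertex of `f` are far from both `x` and `y`. Being
    -- adjacent in the subdivision, they cannot both lie in the clique `K` of the complement.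
    have hfar : ∀ z, (z = x ∨ z = y) → ∀ w, (w = Sum.inl (edgeFst f) ∨
        w = Sum.inr (f, (⟨0, hk⟩ : Fin k))) → (subdivision k G)ᶜ.Adj z w := by
      intro z hz w hw
      rw [compl_adj]
      rcases he z hz with ⟨p, rfl⟩ | hz' <;> rcases hw with rfl | rfl
      · refine ⟨by simp, fun h => ?_⟩
        rw [subdivision_adj_inr_inl] at h
        exact hf' (edgeFst f) (h.imp (fun h => h.1) (fun h => h.1)) (Or.inl rfl)
      · refine ⟨by simp [hfe.symm], fun h => ?_⟩
        rw [subdivision_adj_inr_inr] at h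
        exact hfe h.1.symm
      · obtain ⟨u, hu, rfl⟩ : ∃ u, (u = edgeFst e ∨ u = edgeSnd e) ∧ z = Sum.inl u := by
          rcases hz' with h | h
          exacts [⟨_, Or.inl rfl, h⟩, ⟨_, Or.inr rfl, h⟩]
        refine ⟨fun h => hf' u hu (Or.inl (Sum.inl_injective h)),
          subdivision_adj_inl_inl hk _ _⟩
      · obtain ⟨u, hu, rfl⟩ : ∃ u, (u = edgeFst e ∨ u = edgeSnd e) ∧ z = Sum.inl u := by
          rcases hz' with h | h
          exacts [⟨_, Or.inl rfl, h⟩, ⟨_, Or.inr rfl, h⟩]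
        refine ⟨by simp, fun h => ?_⟩
        rw [subdivision_adj_inl_inr] at h
        exact hf' u hu (h.imp (fun h => h.1) (fun h => h.1))
    have hedge : (subdivision k G).Adj (Sum.inl (edgeFst f)) (Sum.inr (f, (⟨0, hk⟩ : Fin k))) :=
      (subdivision_adj_inl_inr _ _ _).2 (Or.inl ⟨rfl, rfl⟩)
    obtain ⟨w, hw, hwK⟩ : ∃ w, (w = Sum.inl (edgeFst f) ∨
        w = Sum.inr (f, (⟨0, hk⟩ : Fin k))) ∧ w ∉ K := by
      by_contra! hall
      have := hK (hall _ (Or.inl rfl)) (hall _ (Or.inr rfl)) hedge.ne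
      exact ((compl_adj _ _ _).1 this).2 hedge
    exact (ReachIn.single (hfar x (Or.inl rfl) w hw) hx hwK).trans
      (ReachIn.single (hfar y (Or.inr rfl) w hw).symm hwK hy)
  · exact ReachIn.single ((compl_adj _ _ _).2 ⟨hxy, hadj⟩) hx hy

end Subdivision

end AtomsCW
namespace AtomsCW

/-! ### Walls -/

/-- The infinite wall, of which all walls are induced subgraphs. -/
def brickwork : SimpleGraph (ℕ × ℕ) :=
  SimpleGraph.fromRel (fun p q =>
    (p.1 + 1 = q.1 ∧ p.2 = q.2) ∨ (p.1 = q.1 ∧ p.2 + 1 = q.2 ∧ Odd (p.1 + p.2)))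

theorem brickwork_adj (x y x' y' : ℕ) : brickwork.Adj (x, y) (x', y') ↔
    (x + 1 = x' ∧ y = y') ∨ (x' + 1 = x ∧ y = y') ∨
      (x = x' ∧ y + 1 = y' ∧ (x + y) % 2 = 1) ∨ (x = x' ∧ y' + 1 = y ∧ (x' + y') % 2 = 1) := by
  simp only [brickwork, fromRel_adj, ne_eq, Prod.mk.injEq, Nat.odd_iff]
  omega

theorem brickwork_reachIn_row {T : Set (ℕ × ℕ)} {x x' y : ℕ}
    (h : ∀ z, min x x' ≤ z → z ≤ max x x' → (z, y) ∈ T) : ReachIn brickwork T (x, y) (x', y) := by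
  wlog hle : x ≤ x' generalizing x x'
  · exact (this (by simpa only [min_comm, max_comm] using h) (by omega)).symm
  obtain ⟨d, rfl⟩ := Nat.exists_eq_add_of_le hle
  clear hle
  induction d with
  | zero => exact ReachIn.refl _
  | succ d ih =>
    refine (ih (fun z h1 h2 => h z (by omega) (by omega))).trans
      (ReachIn.single ?_ (h _ (by omega) (by omega)) (h _ (by omega) (by omega)))
    rw [brickwork_adj]
    omega

/-- Moving inside the column that consists of the points with given `x / 2`. -/
theorem brickwork_reachIn_column {T : Set (ℕ × ℕ)} {x x' y y' : ℕ} (hx : x / 2 = x' / 2)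
    (hy : y ≤ y') (h : (x, y) ∈ T) (h' : (x', y') ∈ T)
    (hT : ∀ z w, z / 2 = x / 2 → y ≤ w → w < y' → (z + w) % 2 = 1 → (z, w) ∈ T ∧ (z, w + 1) ∈ T) :
    ReachIn brickwork T (x, y) (x', y') := by
  obtain ⟨d, rfl⟩ := Nat.exists_eq_add_of_le hy
  clear hy
  have hrow : ∀ {u v w : ℕ}, u / 2 = v / 2 → (u, w) ∈ T → (v, w) ∈ T →
      ReachIn brickwork T (u, w) (v, w) := by
    intro u v w huv hu hv
    refine brickwork_reachIn_row (fun z h1 h2 => ?_)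
    obtain rfl | rfl : z = u ∨ z = v := by omega
    exacts [hu, hv]
  induction d generalizing x y with
  | zero => exact hrow hx h h'
  | succ d ih =>
    -- Of the two points of the column at height `y`, exactly one has an edge upwards, by parity;
    -- move to it first.
    obtain ⟨z, hz, hodd⟩ : ∃ z, z / 2 = x / 2 ∧ (z + y) % 2 = 1 := by
      rcases Nat.mod_two_eq_zero_or_one (x + y) with hp | hp
      · rcases Nat.mod_two_eq_zero_or_one x with hp' | hp'
        · exact ⟨x + 1, by omega, by omega⟩
        · exact ⟨x - 1, by omega, by omega⟩
      · exact ⟨x, rfl, hp⟩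
    obtain ⟨h1, h2⟩ := hT z y hz le_rfl (by omega) hodd
    have h3 : y + (d + 1) = y + 1 + d := by omega
    rw [h3] at h' hT ⊢
    refine ((hrow hz.symm h h1).trans (ReachIn.single ?_ h1 h2)).trans
      (ih (hz.trans hx) h2 h' (fun v w hv hw hw' => hT v w (hv.trans hz) (by omega) hw'))
    rw [brickwork_adj]
    omega

/-- The points of the wall of height `n`. -/
def wallPoints (n : ℕ) : Set (ℕ × ℕ) :=
  {p | p.1 ≤ 2 * n + 1 ∧ p.2 ≤ n ∧ ¬ (p.1 = 0 ∧ p.2 = 0) ∧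
    ¬ (p.2 = n ∧ n % 2 = 0 ∧ p.1 = 2 * n + 1) ∧ ¬ (p.2 = n ∧ n % 2 = 1 ∧ p.1 = 0)}

theorem mem_wallPoints {n x y : ℕ} : (x, y) ∈ wallPoints n ↔
    x ≤ 2 * n + 1 ∧ y ≤ n ∧ ¬ (x = 0 ∧ y = 0) ∧
    ¬ (y = n ∧ n % 2 = 0 ∧ x = 2 * n + 1) ∧ ¬ (y = n ∧ n % 2 = 1 ∧ x = 0) := Iff.rfl

/-- The coordinates of a vertex of the wall. -/
def wallCoord {n : ℕ} (p : WallVertex n) : ℕ × ℕ := (p.1.1.val, p.1.2.val)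

theorem wallCoord_injective {n : ℕ} : Function.Injective (wallCoord (n := n)) := by
  intro p q h
  simp only [wallCoord, Prod.mk.injEq] at h
  exact Subtype.ext (Prod.ext (Fin.ext h.1) (Fin.ext h.2))

theorem wallCoord_mem {n : ℕ} (p : WallVertex n) : wallCoord p ∈ wallPoints n := by
  obtain ⟨⟨⟨x, hx⟩, ⟨y, hy⟩⟩, h1, h2⟩ := p
  simp only [Nat.even_iff] at h1 h2
  simp only [wallCoord, mem_wallPoints]
  split_ifs at h2 <;> omega

theorem exists_wallCoord_eq {n : ℕ} {p : ℕ × ℕ} (hp : p ∈ wallPoints n) :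
    ∃ q : WallVertex n, wallCoord q = p := by
  obtain ⟨x, y⟩ := p
  rw [mem_wallPoints] at hp
  refine ⟨⟨(⟨x, by omega⟩, ⟨y, by omega⟩), ?_, ?_⟩, rfl⟩
  · simp only; omega
  · simp only [Nat.even_iff]
    split_ifs <;> omega

theorem wall_adj {n : ℕ} (p q : WallVertex n) :
    (wall n).Adj p q ↔ brickwork.Adj (wallCoord p) (wallCoord q) := by
  simp only [wall, brickwork, fromRel_adj, wallCoord_injective.ne_iff]
  rfl

theorem wall_reachIn {n : ℕ} {T : Set (ℕ × ℕ)} (hT : T ⊆ wallPoints n) {S : Set (WallVertex n)}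
    (hS : ∀ p, wallCoord p ∈ T → p ∈ S) {a b : WallVertex n}
    (h : ReachIn brickwork T (wallCoord a) (wallCoord b)) : ReachIn (wall n) S a b := by
  obtain ⟨v, hv⟩ : ∃ v, v = wallCoord b := ⟨_, rfl⟩
  rw [← hv] at h
  induction h generalizing b with
  | refl => rw [wallCoord_injective hv]; exact ReachIn.refl _
  | @tail c d _ hcd ih =>
    obtain ⟨q, rfl⟩ := exists_wallCoord_eq (hT hcd.2.1)
    subst hv
    exact (ih rfl).trans (ReachIn.single ((wall_adj _ _).2 hcd.1) (hS _ hcd.2.1) (hS _ hcd.2.2))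

theorem wall_ncard_neighborSet_le (n : ℕ) (u : WallVertex n) :
    ((wall n).neighborSet u).ncard ≤ 3 := by
  obtain ⟨⟨x, y⟩, hu⟩ : ∃ p, wallCoord u = p := ⟨_, rfl⟩
  have h1 : ((wall n).neighborSet u).ncard ≤
      ({(x + 1, y), (x - 1, y), (x, if (x + y) % 2 = 1 then y + 1 else y - 1)} :
        Set (ℕ × ℕ)).ncard := by
    refine Set.ncard_le_ncard_of_injOn wallCoord ?_ wallCoord_injective.injOn (Set.toFinite _)
    intro v hv
    rw [mem_neighborSet, wall_adj, hu] at hv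
    obtain ⟨⟨x', y'⟩, hv'⟩ : ∃ p, wallCoord v = p := ⟨_, rfl⟩
    rw [hv', brickwork_adj] at hv
    rw [hv']
    simp only [Set.mem_insert_iff, Set.mem_singleton_iff, Prod.mk.injEq]
    split_ifs <;> omega
  refine h1.trans ((Set.ncard_insert_le _ _).trans ?_)
  have := Set.ncard_insert_le (x - 1, y)
    ({(x, if (x + y) % 2 = 1 then y + 1 else y - 1)} : Set (ℕ × ℕ))
  rw [Set.ncard_singleton] at this
  omega

/-- Rows are the horizontal lines, and columns are pairs of consecutive vertical lines. Height `r +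
1` and the shift by one keep the rows off the bottom and top lines, and the columns off the first
and last pairs, so no missing corner is met. -/
theorem wall_hasGrid (r : ℕ) : HasGrid r (wall (r + 1)) := by
  have hsub : ∀ {T : Set (ℕ × ℕ)}, (∀ x y, (x, y) ∈ T → (x, y) ∈ wallPoints (r + 1)) →
      T ⊆ wallPoints (r + 1) := fun h p hp => h p.1 p.2 hp
  refine ⟨wall_ncard_neighborSet_le _, fun i => {p | (wallCoord p).2 = i.val + 1},
    fun i => {p | (wallCoord p).1 / 2 = i.val + 1}, ?_, ?_, ?_, ?_, ?_, ?_⟩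
  · intro i j hij
    rw [Set.disjoint_left]
    intro p hp hp'
    exact hij (Fin.ext (by simpa using (hp : _ = _).symm.trans hp'))
  · intro i j hij
    rw [Set.disjoint_left]
    intro p hp hp'
    exact hij (Fin.ext (by simpa using (hp : _ = _).symm.trans hp'))
  · intro i p hp q hq
    refine wall_reachIn (T := {v | v.2 = i.val + 1 ∧ v.1 ≤ 2 * (r + 1) + 1}) (hsub ?_) ?_ ?_
    · rintro x y ⟨h1, h2⟩
      rw [mem_wallPoints]
      simp only at h1 h2
      omega
    · exact fun p hp => hp.1
    · have h1 := wallCoord_mem p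
      have h2 := wallCoord_mem q
      simp only [Set.mem_ofPred_eq] at hp hq
      rcases hpc : wallCoord p with ⟨x, y⟩
      rcases hqc : wallCoord q with ⟨x', y'⟩
      rw [hpc] at hp h1
      rw [hqc] at hq h2
      simp only at hp hq
      subst hp hq
      rw [mem_wallPoints] at h1 h2
      exact brickwork_reachIn_row (fun z hz hz' => ⟨rfl, by simp only; omega⟩)
  · intro i p hp q hq
    wlog hle : (wallCoord p).2 ≤ (wallCoord q).2 generalizing p q
    · exact (this q hq p hp (by omega)).symm
    refine wall_reachIn (T := {v | v.1 / 2 = i.val + 1 ∧ v.2 ≤ r + 1}) (hsub ?_) ?_ ?_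
    · rintro x y ⟨h1, h2⟩
      rw [mem_wallPoints]
      simp only at h1 h2
      omega
    · exact fun p hp => hp.1
    · have h1 := wallCoord_mem p
      have h2 := wallCoord_mem q
      simp only [Set.mem_ofPred_eq] at hp hq
      rcases hpc : wallCoord p with ⟨x, y⟩
      rcases hqc : wallCoord q with ⟨x', y'⟩
      rw [hpc] at hp h1 hle
      rw [hqc] at hq h2 hle
      rw [mem_wallPoints] at h1 h2
      simp only at hp hq hle
      refine brickwork_reachIn_column (hp.trans hq.symm) hle ⟨hp, h1.2.1⟩ ⟨hq, h2.2.1⟩ ?_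
      intro z w hz hw hw' _
      exact ⟨⟨hz.trans hp, by simp only; omega⟩, hz.trans hp, by simp only; omega⟩
  · intro i j
    obtain ⟨q, hq⟩ := exists_wallCoord_eq (n := r + 1) (p := (2 * (j.val + 1), i.val + 1))
      (by rw [mem_wallPoints]; omega)
    exact ⟨q, by simp [hq], by simp [hq]⟩
  · intro i
    obtain ⟨p, hp⟩ := exists_wallCoord_eq (n := r + 1) (p := (1, i.val + 1))
      (by rw [mem_wallPoints]; omega)
    obtain ⟨q, hq⟩ := exists_wallCoord_eq (n := r + 1) (p := (2, i.val + 1))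
      (by rw [mem_wallPoints]; omega)
    refine ⟨p, by simp [hp], q, by simp [hq], ?_⟩
    rintro rfl
    simp [hp] at hq

/-- The points of the wall of height `n` other than `(s, t)`. -/
def wallPointsErase (n s t : ℕ) : Set (ℕ × ℕ) := {p | p ∈ wallPoints n ∧ p ≠ (s, t)}

theorem mem_wallPointsErase {n s t x y : ℕ} : (x, y) ∈ wallPointsErase n s t ↔
    (x ≤ 2 * n + 1 ∧ y ≤ n ∧ ¬ (x = 0 ∧ y = 0) ∧
      ¬ (y = n ∧ n % 2 = 0 ∧ x = 2 * n + 1) ∧ ¬ (y = n ∧ n % 2 = 1 ∧ x = 0)) ∧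
        ¬ (x = s ∧ y = t) := by
  rw [← mem_wallPoints, ← Prod.mk.injEq]
  rfl

theorem wallPointsErase_reachIn_row {n s t x x' y : ℕ} (hy : y ≠ t)
    (h : (x, y) ∈ wallPointsErase n s t) (h' : (x', y) ∈ wallPointsErase n s t) :
    ReachIn brickwork (wallPointsErase n s t) (x, y) (x', y) := by
  rw [mem_wallPointsErase] at h h'
  refine brickwork_reachIn_row (fun z h1 h2 => ?_)
  rw [mem_wallPointsErase]
  omega

/-- The missing corners do no harm: by parity no vertical edge used here ends in one of them. -/
theorem wallPointsErase_reachIn_column {n s t x x' y y' : ℕ} (hx : x / 2 ≠ s / 2)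
    (hxx : x / 2 = x' / 2) (h : (x, y) ∈ wallPointsErase n s t)
    (h' : (x', y') ∈ wallPointsErase n s t) :
    ReachIn brickwork (wallPointsErase n s t) (x, y) (x', y') := by
  wlog hle : y ≤ y' generalizing x x' y y'
  · exact (this (by omega) hxx.symm h' h (by omega)).symm
  refine brickwork_reachIn_column hxx hle h h' (fun z w hz hw hw' hodd => ?_)
  obtain ⟨h, -⟩ := mem_wallPointsErase.1 h
  obtain ⟨h', -⟩ := mem_wallPointsErase.1 h'
  have hzn : z ≤ 2 * n + 1 := by omega
  constructor
  · exact mem_wallPointsErase.2 ⟨⟨hzn, by omega, by omega, by omega, by omega⟩, by omega⟩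
  · exact mem_wallPointsErase.2 ⟨⟨hzn, by omega, by omega, by omega, by omega⟩, by omega⟩

/-- The hub is the crossing of a row and a column that both avoid the deleted point. A point in an
intact row goes along that row to the hub's column; a point in an intact column goes along that
column to the hub's row. -/
theorem wallPointsErase_exists_hub {n s t : ℕ} (hn : 2 ≤ n) : ∃ c : ℕ × ℕ, ∀ x y,
    (x, y) ∈ wallPointsErase n s t → (y ≠ t ∨ x / 2 ≠ s / 2) →
      ReachIn brickwork (wallPointsErase n s t) (x, y) c := by
  obtain ⟨c, hc, hc'⟩ : ∃ c, c / 2 ≠ s / 2 ∧ (c = 1 ∨ c = 2) := by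
    by_cases h : s / 2 = 0
    · exact ⟨2, by omega, Or.inr rfl⟩
    · exact ⟨1, by omega, Or.inl rfl⟩
  obtain ⟨d, hd, hd'⟩ : ∃ d, d ≠ t ∧ (d = 0 ∨ d = 1) := by
    by_cases h : t = 0
    · exact ⟨1, by omega, Or.inr rfl⟩
    · exact ⟨0, by omega, Or.inl rfl⟩
  have hub : (c, d) ∈ wallPointsErase n s t := mem_wallPointsErase.2 (by omega)
  refine ⟨(c, d), fun x y h hxy => ?_⟩
  have hxn := mem_wallPointsErase.1 h
  rcases hxy with hy | hx
  · have h' : (c, y) ∈ wallPointsErase n s t := mem_wallPointsErase.2 (by omega)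
    exact (wallPointsErase_reachIn_row hy h h').trans
      (wallPointsErase_reachIn_column hc rfl h' hub)
  -- The odd point of the pair is chosen because it is never `(0, 0)`; the other missing corner is
  -- in row `n`, while `d ≤ 1 < n`.
  · have h' : (2 * (x / 2) + 1, d) ∈ wallPointsErase n s t := mem_wallPointsErase.2 (by omega)
    exact (wallPointsErase_reachIn_column hx (by omega) h h').trans
      (wallPointsErase_reachIn_row hd h' hub)

/-- The one point not covered by the hub argument is the partner of the deleted point in its row and
column. It steps sideways into the next column, or vertically if it lies on the left or right
border; the parity of `y` gives the direction, and the missing corners are exactly where that step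
would leave the wall. -/
theorem wallPointsErase_exists_adj {n s x y : ℕ} (hn : 2 ≤ n) (hs : (s, y) ∈ wallPoints n)
    (hx : x / 2 = s / 2) (h : (x, y) ∈ wallPointsErase n s y) :
    ∃ x' y', brickwork.Adj (x, y) (x', y') ∧ (x', y') ∈ wallPointsErase n s y ∧
      (y' ≠ y ∨ x' / 2 ≠ s / 2) := by
  rw [mem_wallPoints] at hs
  rw [mem_wallPointsErase] at h
  simp only [mem_wallPointsErase, brickwork_adj]
  by_cases hpar : s % 2 = 0
  · obtain rfl : x = s + 1 := by omega
    by_cases hlast : s = 2 * n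
    · by_cases hy2 : y % 2 = 0
      · exact ⟨s + 1, y + 1, by omega, by omega, by omega⟩
      · exact ⟨s + 1, y - 1, by omega, by omega, by omega⟩
    · exact ⟨s + 2, y, by omega, by omega, by omega⟩
  · obtain rfl : s = x + 1 := by omega
    by_cases hfirst : x = 0
    · by_cases hy2 : y % 2 = 0
      · exact ⟨x, y - 1, by omega, by omega, by omega⟩
      · exact ⟨x, y + 1, by omega, by omega, by omega⟩
    · exact ⟨x - 1, y, by omega, by omega, by omega⟩

/-- Deleting a vertex of a wall leaves a connected graph. -/
theorem wall_reachIn_compl_singleton {n : ℕ} (hn : 2 ≤ n) (u a b : WallVertex n)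
    (ha : a ≠ u) (hb : b ≠ u) : ReachIn (wall n) {u}ᶜ a b := by
  rcases huc : wallCoord u with ⟨s, t⟩
  have hs := wallCoord_mem u
  rw [huc] at hs
  obtain ⟨c, hc⟩ := wallPointsErase_exists_hub (s := s) (t := t) hn
  have h3 : ∀ x y, (x, y) ∈ wallPointsErase n s t →
      ReachIn brickwork (wallPointsErase n s t) (x, y) c := by
    intro x y h
    by_cases hxy : y ≠ t ∨ x / 2 ≠ s / 2
    · exact hc x y h hxy
    · obtain ⟨rfl, hx⟩ : y = t ∧ x / 2 = s / 2 := by omega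
      obtain ⟨x', y', hadj, h', hne⟩ := wallPointsErase_exists_adj hn hs hx h
      exact (ReachIn.single hadj h h').trans (hc x' y' h' hne)
  have h4 : ∀ p : WallVertex n, p ≠ u →
      ReachIn brickwork (wallPointsErase n s t) (wallCoord p) c := by
    intro p hp
    exact h3 _ _ ⟨wallCoord_mem p, fun h => hp (wallCoord_injective (h.trans huc.symm))⟩
  refine wall_reachIn (fun p hp => hp.1) ?_ ((h4 a ha).trans (h4 b hb).symm)
  rintro p ⟨_, hp⟩ rfl
  exact hp huc

theorem exists_ne_of_three {α : Type*} {p q r : α} (hpq : p ≠ q) (hpr : p ≠ r) (hqr : q ≠ r)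
    (u v : α) : ∃ w, (w = p ∨ w = q ∨ w = r) ∧ w ≠ u ∧ w ≠ v := by
  by_contra! hcon
  have h1 := hcon p (by simp)
  have h2 := hcon q (by simp)
  have h3 := hcon r (by simp)
  by_cases hp : p = u
  · exact hqr ((h2 fun h => hpq (hp.trans h.symm)).trans (h3 fun h => hpr (hp.trans h.symm)).symm)
  · by_cases hq : q = u
    · exact hpr ((h1 hp).trans (h3 fun h => hqr (hq.trans h.symm)).symm)
    · exact hpq ((h1 hp).trans (h2 hq).symm)

/-- The three edges that start at `(1, 0)`, `(3, 0)` and `(1, 1)` and go right are pairwise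
disjoint, and `e` has only two ends with which to meet them. -/
theorem wall_exists_disjoint_edge {n : ℕ} (hn : 2 ≤ n) (e : (wall n).edgeSet) :
    ∃ f : (wall n).edgeSet, ∀ u ∈ e.val, u ∉ f.val := by
  by_contra! hcon
  have key : ∀ x y, x ≤ 3 → 1 ≤ x → y ≤ 1 → ∃ u ∈ e.val, wallCoord u = (x, y) ∨
      wallCoord u = (x + 1, y) := by
    intro x y hx hx1 hy
    obtain ⟨p, hp⟩ := exists_wallCoord_eq (n := n) (p := (x, y)) (by rw [mem_wallPoints]; omega)
    obtain ⟨q, hq⟩ := exists_wallCoord_eq (n := n) (p := (x + 1, y))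
      (by rw [mem_wallPoints]; omega)
    have hadj : (wall n).Adj p q := by
      rw [wall_adj, hp, hq, brickwork_adj]
      omega
    obtain ⟨u, hu, hu'⟩ := hcon ⟨s(p, q), hadj⟩
    rw [Sym2.mem_iff] at hu'
    rcases hu' with rfl | rfl
    exacts [⟨_, hu, Or.inl hp⟩, ⟨_, hu, Or.inr hq⟩]
  obtain ⟨u, hu, hu'⟩ := key 1 0 (by omega) (by omega) (by omega)
  obtain ⟨v, hv, hv'⟩ := key 3 0 (by omega) (by omega) (by omega)
  obtain ⟨w, hw, hw'⟩ := key 1 1 (by omega) (by omega) (by omega)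
  rw [← mk_edgeFst_edgeSnd e, Sym2.mem_iff] at hu hv hw
  have huv : u ≠ v := by
    rintro rfl
    rcases hu' with h | h <;> rcases hv' with h' | h' <;> rw [h] at h' <;> simp at h'
  have huw : u ≠ w := by
    rintro rfl
    rcases hu' with h | h <;> rcases hw' with h' | h' <;> rw [h] at h' <;> simp at h'
  have hvw : v ≠ w := by
    rintro rfl
    rcases hv' with h | h <;> rcases hw' with h' | h' <;> rw [h] at h' <;> simp at h'
  obtain ⟨z, hz, h1, h2⟩ := exists_ne_of_three huv huw hvw (edgeFst e) (edgeSnd e)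
  rcases hz with rfl | rfl | rfl
  exacts [hu.elim h1 h2, hv.elim h1 h2, hw.elim h1 h2]

theorem wall_exists_ne {n : ℕ} (hn : 2 ≤ n) (u v : WallVertex n) : ∃ w, w ≠ u ∧ w ≠ v := by
  have key : ∀ x, 1 ≤ x → x ≤ 3 → ∃ p : WallVertex n, wallCoord p = (x, 0) := fun x h h' =>
    exists_wallCoord_eq (by rw [mem_wallPoints]; omega)
  obtain ⟨p, hp⟩ := key 1 (by omega) (by omega)
  obtain ⟨q, hq⟩ := key 2 (by omega) (by omega)
  obtain ⟨r, hr⟩ := key 3 (by omega) (by omega)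
  have hpq : p ≠ q := by rintro rfl; simp [hp] at hq
  have hpr : p ≠ r := by rintro rfl; simp [hp] at hr
  have hqr : q ≠ r := by rintro rfl; simp [hq] at hr
  obtain ⟨w, _, hw⟩ := exists_ne_of_three hpq hpr hqr u v
  exact ⟨w, hw⟩

theorem subdividedWall_isAtom {k n : ℕ} (hk : 1 ≤ k) (hn : 2 ≤ n) : IsAtom (subdividedWall k n) := by
  obtain ⟨p, hp⟩ := exists_wallCoord_eq (n := n) (p := (1, 0)) (by rw [mem_wallPoints]; omega)
  obtain ⟨q, hq⟩ := exists_wallCoord_eq (n := n) (p := (2, 0)) (by rw [mem_wallPoints]; omega)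
  have hadj : (wall n).Adj p q := by
    rw [wall_adj, hp, hq, brickwork_adj]
    omega
  have : Nonempty (wall n).edgeSet := ⟨⟨s(p, q), hadj⟩⟩
  exact subdivision_isAtom hk (wall_reachIn_compl_singleton hn) (wall_exists_ne hn)

theorem subdividedWall_compl_isAtom {k n : ℕ} (hk : 1 ≤ k) (hn : 2 ≤ n) :
    IsAtom (subdividedWall k n)ᶜ :=
  subdivision_compl_isAtom hk (wall_exists_disjoint_edge hn)

theorem exists_lt_cliqueWidth_subdividedWall {k : ℕ} (hk : 1 ≤ k) (c : ℕ) :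
    ∃ n, 2 ≤ n ∧ c < cliqueWidth (subdividedWall k n) ∧ c < cliqueWidth (subdividedWall k n)ᶜ :=
  ⟨6 * c + 1 + 1, by omega, ((wall_hasGrid (6 * c + 1)).subdivision hk).lt_cliqueWidth⟩

end AtomsCW
namespace AtomsCW

/-! ### Recognizing paths and subdivided claws -/

section Recognition

variable {V : Type*} {G : SimpleGraph V}

theorem exists_adj_dist_eq (hG : G.Connected) {y v : V} {m : ℕ} (h : G.dist y v = m + 1) :
    ∃ w, G.Adj v w ∧ G.dist y w = m := by
  obtain ⟨p, hp⟩ := hG.exists_walk_length_eq_dist v y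
  rw [dist_comm, h] at hp
  cases p with
  | nil => simp at hp
  | @cons _ w _ hadj q =>
    refine ⟨w, hadj, ?_⟩
    rw [Walk.length_cons] at hp
    have h1 := dist_le q
    have h2 := hG.dist_triangle (u := y) (v := w) (w := v)
    rw [dist_eq_one_iff_adj.2 hadj.symm] at h2
    rw [dist_comm] at h1
    omega

theorem dist_lt_card [Finite V] (hG : G.Connected) (x y : V) : G.dist x y < Nat.card V := by
  classical
  have := Fintype.ofFinite V
  obtain ⟨p, hp, hlen⟩ := hG.exists_path_of_dist x y
  rw [← hlen, Nat.card_eq_fintype_card]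
  exact hp.length_lt

theorem eq_of_ncard_le_one {s : Set V} [Finite V] (hs : s.ncard ≤ 1) {a b : V} (ha : a ∈ s)
    (hb : b ∈ s) : a = b :=
  (Set.ncard_le_one (Set.toFinite s)).1 hs a ha b hb

theorem eq_of_ncard_le_two {s : Set V} [Finite V] (hs : s.ncard ≤ 2) {a b c : V} (ha : a ∈ s)
    (hb : b ∈ s) (hc : c ∈ s) (hac : a ≠ c) (hbc : b ≠ c) : a = b := by
  by_contra hab
  have h1 : ({a, b, c} : Set V) ⊆ s := by
    rintro x (rfl | rfl | rfl) <;> assumption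
  have h2 := Set.ncard_le_ncard h1 (Set.toFinite s)
  rw [Set.ncard_eq_three.2 ⟨a, b, c, hab, hac, hbc, rfl⟩] at h2
  omega

/-- A connected graph of maximum degree at most two with a vertex of degree at most one is a
path. -/
theorem nonempty_iso_pathGraph [Finite V] (hG : G.Connected)
    (hdeg : ∀ v, (G.neighborSet v).ncard ≤ 2) {y : V} (hy : (G.neighborSet y).ncard ≤ 1) :
    Nonempty (G ≃g pathGraph (Nat.card V)) := by
  -- No two vertices are equally far from `y`: they would share their predecessor, which already has
  -- a neighbour closer to `y` and so has only one left.
  have hinj : ∀ m, ∀ v w, G.dist y v = m → G.dist y w = m → v = w := by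
    intro m
    induction m using Nat.strong_induction_on with
    | _ m ih =>
      intro v w hv hw
      match m with
      | 0 => exact ((hG.dist_eq_zero_iff).1 hv).symm.trans ((hG.dist_eq_zero_iff).1 hw)
      | 1 =>
        exact eq_of_ncard_le_one hy (dist_eq_one_iff_adj.1 hv) (dist_eq_one_iff_adj.1 hw)
      | m + 2 =>
        obtain ⟨v', hvv, hv'⟩ := exists_adj_dist_eq hG hv
        obtain ⟨w', hww, hw'⟩ := exists_adj_dist_eq hG hw
        obtain rfl := ih (m + 1) (by omega) v' w' hv' hw'
        obtain ⟨u, hu, hu'⟩ := exists_adj_dist_eq hG hv'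
        refine eq_of_ncard_le_two (hdeg v') hvv.symm hww.symm hu ?_ ?_
        · rintro rfl; omega
        · rintro rfl; omega
  let d : V → Fin (Nat.card V) := fun v => ⟨G.dist y v, dist_lt_card hG y v⟩
  have hd : Function.Injective d := fun v w h => hinj _ v w (Fin.ext_iff.1 h) rfl
  have hbij : Function.Bijective d := hd.bijective_of_nat_card_le (by simp)
  refine ⟨⟨Equiv.ofBijective d hbij, ?_⟩⟩
  intro v w
  have hsucc : ∀ {a b}, G.dist y a + 1 = G.dist y b → G.Adj a b := by
    intro a b hab
    obtain ⟨c, hbc, hc⟩ := exists_adj_dist_eq hG hab.symm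
    rw [hinj _ a c rfl hc]
    exact hbc.symm
  rw [Equiv.ofBijective_apply, Equiv.ofBijective_apply, pathGraph_adj]
  constructor
  · rintro (h | h)
    · exact hsucc h
    · exact (hsucc h).symm
  · intro h
    have h1 : G.dist y v ≠ G.dist y w := fun h' => h.ne (hinj _ v w h' rfl)
    have h2 := h.diff_dist_adj (u := y)
    change G.dist y v + 1 = G.dist y w ∨ G.dist y w + 1 = G.dist y v
    omega

/-- A graph is acyclic if its vertices can be ranked in such a way that each vertex has at most one
neighbour of at most its own rank. -/
theorem isAcyclic_of_rank (f : V → ℕ)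
    (hf : ∀ x y z, G.Adj x y → G.Adj x z → f y ≤ f x → f z ≤ f x → y = z) : G.IsAcyclic := by
  classical
  intro v c hc
  -- On a cycle, a vertex of maximum rank would have two neighbours of at most its own rank.
  obtain ⟨x, hx, hmax⟩ := c.support.toFinset.exists_max_image f ⟨v, by simp⟩
  rw [List.mem_toFinset] at hx
  have h2 := hc.ncard_neighborSet_toSubgraph_eq_two hx
  obtain ⟨y, z, hyz, hset⟩ := Set.ncard_eq_two.1 h2
  have key : ∀ w ∈ c.toSubgraph.neighborSet x, G.Adj x w ∧ f w ≤ f x := by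
    intro w hw
    refine ⟨c.toSubgraph.adj_sub hw, hmax w ?_⟩
    rw [List.mem_toFinset, ← c.mem_verts_toSubgraph]
    exact c.toSubgraph.edge_vert hw.symm
  have hy := key y (by rw [hset]; simp)
  have hz := key z (by rw [hset]; simp)
  exact hyz (hf x y z hy.1 hz.1 hy.2 hz.2)

theorem exists_ncard_neighborSet_le_one_of_rank [Finite V] [Nonempty V] (f : V → ℕ)
    (hf : ∀ x y z, G.Adj x y → G.Adj x z → f y ≤ f x → f z ≤ f x → y = z) :
    ∃ x, (G.neighborSet x).ncard ≤ 1 := by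
  obtain ⟨x, hx⟩ := Finite.exists_max f
  exact ⟨x, (Set.ncard_le_one (Set.toFinite _)).2
    fun y hy z hz => hf x y z hy hz (hx y) (hx z)⟩

theorem ncard_neighborSet_eq_degree [Fintype V] [DecidableRel G.Adj] (v : V) :
    (G.neighborSet v).ncard = G.degree v := by
  rw [← card_neighborSet_eq_degree, ← Nat.card_eq_fintype_card, Nat.card_coe_set_eq]

/-- A tree with exactly one vertex of degree three and no other vertex of degree more than two has
exactly three leaves. -/
theorem ncard_leaves_eq_three [Finite V] (hG : G.IsTree) {x : V}
    (hx : (G.neighborSet x).ncard = 3) (hdeg : ∀ v ≠ x, (G.neighborSet v).ncard ≤ 2) :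
    {v : V | (G.neighborSet v).ncard = 1}.ncard = 3 := by
  classical
  have := Fintype.ofFinite V
  have hnt : Nontrivial V := by
    obtain ⟨y, hy⟩ : (G.neighborSet x).Nonempty := Set.nonempty_of_ncard_ne_zero (by omega)
    exact ⟨x, y, (show G.Adj x y from hy).ne⟩
  have hpos : ∀ v, 1 ≤ G.degree v := fun v => hG.1.preconnected.degree_pos_of_nontrivial v
  have hsum := G.sum_degrees_eq_twice_card_edges
  have hedges := hG.card_edgeFinset
  have hset : {v : V | (G.neighborSet v).ncard = 1} =
      ((Finset.univ.filter fun v => G.degree v = 1 : Finset V) : Set V) := by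
    ext v
    simp [ncard_neighborSet_eq_degree]
  rw [hset, Set.ncard_coe_finset]
  simp only [ncard_neighborSet_eq_degree] at hx hdeg
  -- Handshake count: with `L` leaves and `N` vertices, summing gives `2 * (N - 1) + L = 2 * N + 1`.
  have hcount : ∑ v, (G.degree v + if G.degree v = 1 then 1 else 0) =
      ∑ v, (2 + if v = x then 1 else 0) := by
    refine Finset.sum_congr rfl (fun v _ => ?_)
    have h1 := hpos v
    by_cases hvx : v = x
    · subst hvx
      simp [hx]
    · have h2 := hdeg v hvx
      rw [if_neg hvx]
      split_ifs <;> omega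
  have hone : ∑ v, (if v = x then 1 else 0) = 1 := by simp
  rw [Finset.sum_add_distrib, Finset.sum_add_distrib, hsum, ← Finset.card_filter, hone,
    Finset.sum_const, Finset.card_univ, smul_eq_mul] at hcount
  omega

theorem exists_isSubdividedClaw [Finite V] (hG : G.IsTree) {x : V}
    (hx : (G.neighborSet x).ncard = 3) (hdeg : ∀ v ≠ x, (G.neighborSet v).ncard ≤ 2) :
    ∃ h i j : ℕ, 1 ≤ h ∧ h ≤ i ∧ i ≤ j ∧ IsSubdividedClaw h i j G := by
  obtain ⟨a, b, c, hab, hac, hbc, hset⟩ := Set.ncard_eq_three.1 (ncard_leaves_eq_three hG hx hdeg)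
  have hpos : ∀ v, (G.neighborSet v).ncard = 1 → 1 ≤ G.dist x v := by
    intro v hv
    refine hG.1.pos_dist_of_ne ?_
    rintro rfl
    omega
  have key : ∀ p q r : V, p ≠ q → p ≠ r → q ≠ r →
      {v : V | (G.neighborSet v).ncard = 1} = {p, q, r} →
      G.dist x p ≤ G.dist x q → G.dist x q ≤ G.dist x r →
      ∃ h i j : ℕ, 1 ≤ h ∧ h ≤ i ∧ i ≤ j ∧ IsSubdividedClaw h i j G := by
    intro p q r hpq hpr hqr hs h1 h2
    have hp : p ∈ {v : V | (G.neighborSet v).ncard = 1} := by rw [hs]; simp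
    exact ⟨_, _, _, hpos p hp, h1, h2, hG, x, p, q, r, hx, hpq, hpr, hqr, hs, rfl, rfl, rfl⟩
  have hperm : ∀ p q r : V, (∀ v, (v = a ∨ v = b ∨ v = c) ↔ (v = p ∨ v = q ∨ v = r)) →
      {v : V | (G.neighborSet v).ncard = 1} = {p, q, r} := fun p q r h => by
    rw [hset]
    ext v
    exact h v
  rcases le_total (G.dist x a) (G.dist x b) with h1 | h1
  · rcases le_total (G.dist x b) (G.dist x c) with h2 | h2
    · exact key a b c hab hac hbc hset h1 h2
    · rcases le_total (G.dist x a) (G.dist x c) with h3 | h3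
      · exact key a c b hac hab hbc.symm (hperm _ _ _ (by tauto)) h3 h2
      · exact key c a b hac.symm hbc.symm hab (hperm _ _ _ (by tauto)) h3 h1
  · rcases le_total (G.dist x a) (G.dist x c) with h2 | h2
    · exact key b a c hab.symm hbc hac (hperm _ _ _ (by tauto)) h1 h2
    · rcases le_total (G.dist x b) (G.dist x c) with h3 | h3
      · exact key b c a hbc hab.symm hac.symm (hperm _ _ _ (by tauto)) h3 h2
      · exact key c b a hbc.symm hac.symm hab.symm (hperm _ _ _ (by tauto)) h3 h1

/-- A connected graph with a ranking as in `isAcyclic_of_rank`, of maximum degree at most three and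
with at most one vertex of degree three, is a subdivided claw or a path. -/
theorem isSubdividedClaw_or_path_of_rank [Finite V] (hG : G.Connected) (f : V → ℕ)
    (hf : ∀ x y z, G.Adj x y → G.Adj x z → f y ≤ f x → f z ≤ f x → y = z)
    (hdeg : ∀ v, (G.neighborSet v).ncard ≤ 3)
    (huniq : ∀ v w, 2 < (G.neighborSet v).ncard → 2 < (G.neighborSet w).ncard → v = w) :
    (∃ h i j : ℕ, 1 ≤ h ∧ h ≤ i ∧ i ≤ j ∧ IsSubdividedClaw h i j G) ∨
      ∃ n : ℕ, 1 ≤ n ∧ Nonempty (G ≃g pathGraph n) := by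
  have := hG.nonempty
  by_cases hx : ∃ x, 2 < (G.neighborSet x).ncard
  · obtain ⟨x, hx⟩ := hx
    refine Or.inl (exists_isSubdividedClaw ⟨hG, isAcyclic_of_rank f hf⟩
      (x := x) (by have := hdeg x; omega) (fun v hv => ?_))
    by_contra! hlt
    exact hv (huniq v x hlt hx)
  · push Not at hx
    obtain ⟨y, hy⟩ := exists_ncard_neighborSet_le_one_of_rank f hf
    exact Or.inr ⟨Nat.card V, Nat.card_pos, nonempty_iso_pathGraph hG hx hy⟩

theorem le_add_dist_of_adj (hG : G.Connected) (f : V → ℕ) (hf : ∀ x y, G.Adj x y → f y ≤ f x + 1)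
    (x y : V) : f y ≤ f x + G.dist x y := by
  obtain ⟨p, hp⟩ := hG.exists_walk_length_eq_dist x y
  rw [← hp]
  clear hp
  induction p with
  | nil => simp
  | cons h p ih =>
    have := hf _ _ h
    rw [Walk.length_cons]
    omega

theorem ncard_neighborSet_le_of_embedding {W : Type*} [Finite W] {H : SimpleGraph W}
    (φ : G ↪g H) (v : V) : (G.neighborSet v).ncard ≤ (H.neighborSet (φ v)).ncard :=
  Set.ncard_le_ncard_of_injOn φ (fun _ hw => φ.map_adj_iff.2 hw) φ.injective.injOn (Set.toFinite _)

end Recognition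

/-! ### Small induced subgraphs of subdivisions -/

section Small

variable {V : Type} {k : ℕ} {G : SimpleGraph V}

open Classical in
/-- The distance from `u` in the `k`-subdivision of `G`, truncated at `k + 1`. -/
noncomputable def branchDist (k : ℕ) (G : SimpleGraph V) (u : V) : V ⊕ (G.edgeSet × Fin k) → ℕ
  | Sum.inl v => if v = u then 0 else k + 1
  | Sum.inr (e, p) =>
    if edgeFst e = u then p.val + 1 else if edgeSnd e = u then k - p.val else k + 1

theorem branchDist_le_of_adj (hk : 1 ≤ k) (u : V) {x y : V ⊕ (G.edgeSet × Fin k)}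
    (h : (subdivision k G).Adj x y) : branchDist k G u y ≤ branchDist k G u x + 1 := by
  rcases x with v | ⟨e, p⟩ <;> rcases y with w | ⟨f, q⟩
  · exact absurd h (subdivision_adj_inl_inl hk v w)
  · rw [subdivision_adj_inl_inr] at h
    have hne := (adj_edgeFst_edgeSnd f).ne
    simp only [branchDist]
    rcases h with ⟨rfl, h⟩ | ⟨rfl, h⟩
    · split_ifs <;> omega
    · split_ifs with h1 h2 <;> first | omega | exact absurd (h1.trans h2.symm) hne
  · rw [subdivision_adj_inr_inl] at h
    simp only [branchDist]
    rcases h with ⟨rfl, h⟩ | ⟨rfl, h⟩ <;> split_ifs <;> omega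
  · rw [subdivision_adj_inr_inr] at h
    obtain ⟨rfl, h⟩ := h
    simp only [branchDist]
    split_ifs <;> omega

/-- Within distance `k` of `u` the subdivision consists of disjoint paths leaving `u`. There the
only neighbour not farther from `u` is the preceding vertex on the path; the far end has value `k +
1`. -/
theorem branchDist_unique (hk : 1 ≤ k) (u : V) {x y z : V ⊕ (G.edgeSet × Fin k)}
    (hy : (subdivision k G).Adj x y) (hz : (subdivision k G).Adj x z)
    (hx : branchDist k G u x ≤ k)
    (hyx : branchDist k G u y ≤ branchDist k G u x)
    (hzx : branchDist k G u z ≤ branchDist k G u x) : y = z := by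
  rcases x with v | ⟨e, p⟩
  · rcases y with w | ⟨f, q⟩
    · exact absurd hy (subdivision_adj_inl_inl hk v w)
    · simp only [branchDist] at hx hyx
      split_ifs at hx hyx <;> omega
  · have hne := (adj_edgeFst_edgeSnd e).ne
    rcases y with w | ⟨f, q⟩ <;> rcases z with w' | ⟨f', q'⟩
    · rw [subdivision_adj_inr_inl] at hy hz
      simp only [branchDist] at hx hyx hzx
      have h1 : w = u := by
        by_contra h
        rw [if_neg h] at hyx
        omega
      have h2 : w' = u := by
        by_contra h
        rw [if_neg h] at hzx
        omega
      rw [h1, h2]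
    · rw [subdivision_adj_inr_inl] at hy
      rw [subdivision_adj_inr_inr] at hz
      obtain ⟨rfl, hz⟩ := hz
      simp only [branchDist] at hx hyx hzx
      rcases hy with ⟨rfl, hy⟩ | ⟨rfl, hy⟩
      · split_ifs at hx hyx hzx <;> omega
      · split_ifs at hx hyx hzx with h1 h2 <;> first | omega | exact absurd (h1.trans h2.symm) hne
    · rw [subdivision_adj_inr_inl] at hz
      rw [subdivision_adj_inr_inr] at hy
      obtain ⟨rfl, hy⟩ := hy
      simp only [branchDist] at hx hyx hzx
      rcases hz with ⟨rfl, hz⟩ | ⟨rfl, hz⟩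
      · split_ifs at hx hyx hzx <;> omega
      · split_ifs at hx hyx hzx with h1 h2 <;> first | omega | exact absurd (h1.trans h2.symm) hne
    · rw [subdivision_adj_inr_inr] at hy hz
      obtain ⟨rfl, hy⟩ := hy
      obtain ⟨rfl, hz⟩ := hz
      simp only [branchDist] at hx hyx hzx
      have : q = q' := by
        rw [Fin.ext_iff]
        split_ifs at hx hyx hzx <;> omega
      rw [this]

/-- A connected graph on at most `k` vertices has distances less than `k`. If its image contains a
branch vertex `u`, the distance from `u` is a suitable ranking and `u` is the only possible vertex
of degree three; otherwise the position along a subdivided edge is a suitable ranking. -/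
theorem isSubdividedClaw_or_path_of_embedding [Finite V] (hk : 1 ≤ k)
    (hdeg : ∀ u, (G.neighborSet u).ncard ≤ 3) {C : Type*} [Finite C] {H : SimpleGraph C}
    (hH : H.Connected) (hcard : Nat.card C ≤ k) (φ : H ↪g subdivision k G) :
    (∃ h i j : ℕ, 1 ≤ h ∧ h ≤ i ∧ i ≤ j ∧ IsSubdividedClaw h i j H) ∨
      ∃ n : ℕ, 1 ≤ n ∧ Nonempty (H ≃g pathGraph n) := by
  have hdegH : ∀ v, (H.neighborSet v).ncard ≤ 3 := fun v =>
    (ncard_neighborSet_le_of_embedding φ v).trans (subdivision_ncard_neighborSet_le hk hdeg _)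
  have hbranch : ∀ v, 2 < (H.neighborSet v).ncard → ∃ u, φ v = Sum.inl u := by
    intro v hv
    have h1 := hv.trans_le (ncard_neighborSet_le_of_embedding φ v)
    rcases hφ : φ v with u | ⟨e, p⟩
    · exact ⟨u, rfl⟩
    · rw [hφ] at h1
      have := subdivision_ncard_neighborSet_inr_le e p
      omega
  by_cases hu : ∃ x u, φ x = Sum.inl u
  · obtain ⟨x, u, hxu⟩ := hu
    have hle : ∀ v, branchDist k G u (φ v) < k := by
      intro v
      have h1 := le_add_dist_of_adj hH (fun v => branchDist k G u (φ v))
        (fun a b hab => branchDist_le_of_adj hk u (φ.map_adj_iff.2 hab)) x v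
      have h2 := dist_lt_card hH x v
      have h3 : branchDist k G u (φ x) = 0 := by rw [hxu]; simp [branchDist]
      simp only [h3] at h1
      omega
    refine isSubdividedClaw_or_path_of_rank hH (fun v => branchDist k G u (φ v)) ?_ hdegH ?_
    · intro a b c hab hac hba hca
      exact φ.injective (branchDist_unique hk u (φ.map_adj_iff.2 hab) (φ.map_adj_iff.2 hac)
        (hle a).le hba hca)
    -- Any other branch vertex has truncated distance `k + 1`, which is out of reach.
    · have key : ∀ v, 2 < (H.neighborSet v).ncard → φ v = Sum.inl u := by
        intro v hv
        obtain ⟨w, hw⟩ := hbranch v hv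
        have h1 := hle v
        rw [hw] at h1 ⊢
        by_contra hne
        have hne' : w ≠ u := fun h => hne (by rw [h])
        simp only [branchDist, if_neg hne'] at h1
        omega
      exact fun v w hv hw => φ.injective ((key v hv).trans (key w hw).symm)
  · push Not at hu
    refine isSubdividedClaw_or_path_of_rank hH
      (fun v => Sum.elim (fun _ => 0) (fun ep => ep.2.val) (φ v)) ?_ hdegH
      (fun v _ hv _ => absurd (hbranch v hv) (by simpa using hu v))
    intro a b c hab hac hba hca
    have hab' := φ.map_adj_iff.2 hab
    have hac' := φ.map_adj_iff.2 hac
    rcases ha : φ a with u | ⟨e, p⟩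
    · exact absurd ha (hu a u)
    rcases hb : φ b with u | ⟨f, q⟩
    · exact absurd hb (hu b u)
    rcases hc : φ c with u | ⟨g, r⟩
    · exact absurd hc (hu c u)
    rw [ha, hb, subdivision_adj_inr_inr] at hab'
    rw [ha, hc, subdivision_adj_inr_inr] at hac'
    simp only [ha, hb, hc, Sum.elim_inr] at hba hca
    obtain ⟨rfl, h1⟩ := hab'
    obtain ⟨rfl, h2⟩ := hac'
    refine φ.injective ?_
    have : q = r := by
      rw [Fin.ext_iff]
      omega
    rw [hb, hc, this]

/-- All induced subgraphs on at most `k` vertices of the `k`-subdivision of a graph of maximum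
degree at most three lie in `𝒮`. -/
theorem inS_of_isIndContained_subdivision [Finite V] (hk : 1 ≤ k)
    (hdeg : ∀ u, (G.neighborSet u).ncard ≤ 3) {U : Type*} [Finite U] {H : SimpleGraph U}
    (hcard : Nat.card U ≤ k) (hH : H ⊴ subdivision k G) : InS H := by
  obtain ⟨φ⟩ := hH
  intro c
  exact isSubdividedClaw_or_path_of_embedding hk hdeg c.connected_toSimpleGraph
    ((Finite.card_subtype_le _).trans hcard) (φ.comp (Embedding.induce c.supp))

/-- The graph without vertices has no components and so lies in `𝒮` vacuously. This yields `1 ≤ k`,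
so that every edge of the wall is really subdivided. -/
theorem one_le_card_of_not_inS {U : Type*} [Finite U] {H : SimpleGraph U} (h : ¬ InS H) :
    1 ≤ Nat.card U := by
  by_contra! hcard
  have : IsEmpty U := Finite.card_eq_zero_iff.1 (by omega)
  refine h (fun c => ?_)
  induction c using ConnectedComponent.ind with
  | _ v => exact isEmptyElim v

end Small

theorem isFreeAtom_subdividedWall {V₁ V₂ : Type*} [Finite V₁] [Finite V₂] {H₁ : SimpleGraph V₁}
    {H₂ : SimpleGraph V₂} (h₁ : ¬ InS H₁) (h₂ : ¬ InS H₂) {k n : ℕ} (hk₁ : Nat.card V₁ ≤ k)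
    (hk₂ : Nat.card V₂ ≤ k) (hn : 2 ≤ n) : IsFreeAtom H₁ H₂ (subdividedWall k n) := by
  have hk : 1 ≤ k := (one_le_card_of_not_inS h₁).trans hk₁
  exact ⟨fun h => h₁ (inS_of_isIndContained_subdivision hk (wall_ncard_neighborSet_le n) hk₁ h),
    fun h => h₂ (inS_of_isIndContained_subdivision hk (wall_ncard_neighborSet_le n) hk₂ h),
    subdividedWall_isAtom hk hn⟩

theorem isFreeAtom_compl_subdividedWall {V₁ V₂ : Type*} [Finite V₁] [Finite V₂]
    {H₁ : SimpleGraph V₁} {H₂ : SimpleGraph V₂} (h₁ : ¬ InS H₁ᶜ) (h₂ : ¬ InS H₂ᶜ) {k n : ℕ}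
    (hk₁ : Nat.card V₁ ≤ k) (hk₂ : Nat.card V₂ ≤ k) (hn : 2 ≤ n) :
    IsFreeAtom H₁ H₂ (subdividedWall k n)ᶜ := by
  have hk : 1 ≤ k := (one_le_card_of_not_inS h₁).trans hk₁
  refine ⟨fun h => h₁ ?_, fun h => h₂ ?_, subdividedWall_compl_isAtom hk hn⟩
  · exact inS_of_isIndContained_subdivision hk (wall_ncard_neighborSet_le n) hk₁
      (by simpa using h.compl)
  · exact inS_of_isIndContained_subdivision hk (wall_ncard_neighborSet_le n) hk₂
      (by simpa using h.compl)

end AtomsCW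

theorem mainTheorem6 {V₁ V₂ : Type*} [Finite V₁] [Finite V₂]
    (H₁ : SimpleGraph V₁) (H₂ : SimpleGraph V₂) :
    -- the class of (H₁, H₂)-free atoms has unbounded clique-width
    (((¬ AtomsCW.InS H₁ ∧ ¬ AtomsCW.InS H₂) ∨ (¬ AtomsCW.InS H₁ᶜ ∧ ¬ AtomsCW.InS H₂ᶜ)) →
      ¬ AtomsCW.HasBoundedCliqueWidth (fun _ G => AtomsCW.IsFreeAtom H₁ H₂ G)) ∧
    -- in the first case this is witnessed by subdivided walls
    ((¬ AtomsCW.InS H₁ ∧ ¬ AtomsCW.InS H₂) →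
      (∀ n : ℕ, 2 ≤ n → AtomsCW.IsFreeAtom H₁ H₂
        (AtomsCW.subdividedWall (max (Nat.card V₁) (Nat.card V₂)) n)) ∧
      (∀ c : ℕ, ∃ n : ℕ, 2 ≤ n ∧ c < AtomsCW.cliqueWidth
        (AtomsCW.subdividedWall (max (Nat.card V₁) (Nat.card V₂)) n))) ∧
    -- in the second case by their complements
    ((¬ AtomsCW.InS H₁ᶜ ∧ ¬ AtomsCW.InS H₂ᶜ) →
      (∀ n : ℕ, 2 ≤ n → AtomsCW.IsFreeAtom H₁ H₂
        (AtomsCW.subdividedWall (max (Nat.card V₁) (Nat.card V₂)) n)ᶜ) ∧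
      (∀ c : ℕ, ∃ n : ℕ, 2 ≤ n ∧ c < AtomsCW.cliqueWidth
        (AtomsCW.subdividedWall (max (Nat.card V₁) (Nat.card V₂)) n)ᶜ)) := by

  have h1 : (¬ AtomsCW.InS H₁ ∧ ¬ AtomsCW.InS H₂) →
      (∀ n : ℕ, 2 ≤ n → AtomsCW.IsFreeAtom H₁ H₂
        (AtomsCW.subdividedWall (max (Nat.card V₁) (Nat.card V₂)) n)) ∧
      (∀ c : ℕ, ∃ n : ℕ, 2 ≤ n ∧ c < AtomsCW.cliqueWidth
        (AtomsCW.subdividedWall (max (Nat.card V₁) (Nat.card V₂)) n)) := by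
    rintro ⟨h₁, h₂⟩
    have hk := (AtomsCW.one_le_card_of_not_inS h₁).trans (le_max_left _ (Nat.card V₂))
    refine ⟨fun n hn => AtomsCW.isFreeAtom_subdividedWall h₁ h₂ (le_max_left _ _)
      (le_max_right _ _) hn, fun c => ?_⟩
    obtain ⟨n, hn, hc, -⟩ := AtomsCW.exists_lt_cliqueWidth_subdividedWall hk c
    exact ⟨n, hn, hc⟩
  have h2 : (¬ AtomsCW.InS H₁ᶜ ∧ ¬ AtomsCW.InS H₂ᶜ) →
      (∀ n : ℕ, 2 ≤ n → AtomsCW.IsFreeAtom H₁ H₂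
        (AtomsCW.subdividedWall (max (Nat.card V₁) (Nat.card V₂)) n)ᶜ) ∧
      (∀ c : ℕ, ∃ n : ℕ, 2 ≤ n ∧ c < AtomsCW.cliqueWidth
        (AtomsCW.subdividedWall (max (Nat.card V₁) (Nat.card V₂)) n)ᶜ) := by
    rintro ⟨h₁, h₂⟩
    have hk := (AtomsCW.one_le_card_of_not_inS h₁).trans (le_max_left _ (Nat.card V₂))
    refine ⟨fun n hn => AtomsCW.isFreeAtom_compl_subdividedWall h₁ h₂ (le_max_left _ _)
      (le_max_right _ _) hn, fun c => ?_⟩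
    obtain ⟨n, hn, -, hc⟩ := AtomsCW.exists_lt_cliqueWidth_subdividedWall hk c
    exact ⟨n, hn, hc⟩
  refine ⟨?_, h1, h2⟩
  rintro (h | h) ⟨c, hc⟩
  · obtain ⟨n, hn, hlt⟩ := (h1 h).2 c
    exact absurd (hc _ _ ((h1 h).1 n hn)) (by omega)
  · obtain ⟨n, hn, hlt⟩ := (h2 h).2 c
    exact absurd (hc _ _ ((h2 h).1 n hn)) (by omega)
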